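/- **Setting.** Let $G=(V,E)$ be a labeled graph with $n$ vertices and maximum degree $\Delta$: the vertices have distinct IDs that are smaller than $n^b$ for a constant $b$, and the neighbors of each vertex are numbered by ports. A deterministic stateless centralized local (CentLocal) algorithm knows $n$ and $\Delta$ and accesses $G$ by adaptive probes $(v,i)$ ("who is the $i$-th neighbor of $v$?"; the answer contains the ID of the neighbor $u$, the port of $u$ that leads back to $v$, and the weight of the edge). Its *probe radius* is at most $r$ if, on every query $e\in E$, all the vertices that it probes are at distance at most $r$ from an endpoint of $e$. Let $\log^* x=\min\{i:\log_2^{(i)}x\le 1\}$. Let $0<\varepsilon<1$. The edge weights are integer powers of $\beta$ in $[\varepsilon/n,1]$, where $\beta=1-\varepsilon/3$ or $\beta=1-\varepsilon/2$, and $w_{\min}(\varepsilon)=\max\{\varepsilon/n,\min_e w(e)\}$. Put $\ell=\max\{2,\log_2(1/w_{\min}(\varepsilon))\}$, $k=\lceil 3/\varepsilon\rceil$, and let $L\ge 1$ with $L\le c_L\cdot\frac1\varepsilon\log_2\frac2\varepsilon$ for a constant $c_L$. *Augmenting paths.* For a matching $M$, an $(M,[1,k])$-augmenting path is an $M$-alternating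 simple path or simple cycle $p$ such that $M\oplus E(p)$ is a matching, the gain $g_M(p)=w(p\setminus M)-w(p\cap M)$ is positive, and $|E(p)\setminus M|\le k$. The possible gains are the positive numbers $\sum_{s\le a}x_s-\sum_{t\le c}y_t$ with $0\le a\le k$, $0\le c\le k+1$, where all $x_s,y_t$ are integer powers of $\beta$ in $[w_{\min}(\varepsilon),1]$. Let $G_k$ be the graph whose vertices are the simple paths and cycles with between $1$ and $2k+1$ edges in $G$, two of them adjacent if they share a vertex. *Coloring subroutine.* $C$ is a CentLocal vertex coloring algorithm that, given upper bounds $N$ on the IDs and $D$ on the degrees of a labeled graph, computes a proper coloring with $\mathrm{poly}(D)$ colors and has probe radius $O(\log^* N+\mathrm{poly}(D))$. *The oracles.* Let $g_1,\dots,g_{T}$ be a list of gains. The oracle $\mathcal O_{1,0}$ always answers "false". For $1\le i\le L$ and $1\le j\le T$, the predecessor $\mathrm{prev}(i,j)$ is $(i,j-1)$, where $(i,0)$ for $i\ge2$ stands for $(i-1,T)$. Let $M$ denote the set of edges accepted by $\mathcal O_{\mathrm{prev}(i,j)}$. On an edge $e=\{u,v\}$, $\mathcal O_{i,j}$ returns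 $\tau\oplus\rho$, where $\tau=\mathcal O_{\mathrm{prev}(i,j)}(e)$ and $\rho=\mathcal A_{i,j}(e)$. The procedure $\mathcal A_{i,j}$ explores by BFS the balls of radius $2k$ around $u$ and $v$, calls $\mathcal O_{\mathrm{prev}(i,j)}$ on all the edges induced by the union of these balls, lists all $(M,[1,k])$-augmenting paths with gain $g_j$ that contain $e$, and returns "true" if one of them is in the maximal independent set of $H_{i,j}$ computed as follows. $H_{i,j}$ is the subgraph of $G_k$ induced by the $(M,[1,k])$-augmenting paths with gain $g_j$; the edges of $H_{i,j}$ are directed from the higher to the lower color in the coloring of $G_k$ computed by $C$ (with probes to $G_k$ simulated by probes to $G$); a DFS along directed edges puts $p$ into the set if no out-neighbor of $p$ is in it. A probe to $H_{i,j}$ (or to $G_k$) at $p$ is simulated by exploring the ball of radius $2k+1$ around every vertex $v$ of $p$ and (for $H_{i,j}$) calling $\mathcal O_{\mathrm{prev}(i,j)}$ on all the edges induced by the ball, and then listing all the relevant paths that contain $v$. **Lemma.** Coloring algorithms $C$ as above exist. For every such $C$, the following holds, where the constants in the $O(1/\varepsilon)$-exponents depend only on $b$, $c_L$, $c_T$ and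 on the constants of $C$. 1. If $g_1>\dots>g_{T_k}$ are all the possible gains ($T_k$ is their number), then the probe radius of $\mathcal O_{L,T_k}$ satisfies $$ r_G(\mathcal O_{L,T_k})\;\le\;\bigl(\log^* n+\Delta^{O(1/\varepsilon)}\bigr)\cdot \ell^{\,O(1/\varepsilon)} .$$ In particular, if $w_{\min}(\varepsilon)\le 1/4$, then $$ r_G(\mathcal O_{L,T_k})\;\le\;\bigl(\log^* n+\Delta^{O(1/\varepsilon)}\bigr)\cdot\bigl(\log_2 (1/w_{\min}(\varepsilon))\bigr)^{O(1/\varepsilon)} .$$ 2. For an arbitrary list of $T_k\le (c_T\,\ell/\varepsilon)^{2k+1}$ gains (for example a list that contains all the possible gains and is padded to this length), the probe radius of $\mathcal O_{L,T_k}$ satisfies $$ r_G(\mathcal O_{L,T_k})\;\le\;\bigl(\log^* n+\Delta^{O(1/\varepsilon)}\bigr)\cdot (\ell/\varepsilon)^{O(1/\varepsilon)} .$$ -/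

import Mathlib

/-- The iterated logarithm `log* x = min {i : log^(i) x ≤ 1}` (base 2). -/
noncomputable def logStar (x : ℝ) : ℕ :=
  sInf {i : ℕ | (Real.logb 2)^[i] x ≤ 1}

/-! ### Labeled graphs and algorithms that access them by probes -/

/-- A finite labeled graph.  A vertex is identified with its ID, a natural number; `ports v` lists
the neighbors of `v` in the order of their port numbers (ports are numbered from `0`). -/
structure LabeledGraph where
  graph : SimpleGraph ℕ
  verts : Finset ℕ
  ports : ℕ → List ℕ
  mem_verts : ∀ v u, graph.Adj v u → v ∈ verts
  mem_ports : ∀ v u, u ∈ ports v ↔ graph.Adj v u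
  nodup_ports : ∀ v, (ports v).Nodup

namespace LabeledGraph

/-- The number of vertices `n`. -/
def order (G : LabeledGraph) : ℕ := G.verts.card

/-- The maximum degree `Δ`. -/
def maxDeg (G : LabeledGraph) : ℕ := G.verts.sup fun v => (G.ports v).length

/-- The answer to the probe `(v, i)`: "null" if `v` has no port `i`; otherwise the ID of the
neighbor `u` of `v` at port `i`, together with the port of `u` that points back to `v`. -/
def answer (G : LabeledGraph) (v i : ℕ) : Option (ℕ × ℕ) :=
  (G.ports v)[i]?.map fun u => (u, (G.ports u).idxOf v)

/-- The answer to a probe in an edge-weighted graph also contains the weight of the edge. -/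
def wanswer (G : LabeledGraph) (w : Sym2 ℕ → ℝ) (v i : ℕ) : Option (ℕ × ℕ × ℝ) :=
  (G.ports v)[i]?.map fun u => (u, (G.ports u).idxOf v, w s(v, u))

end LabeledGraph

/-- A deterministic stateless (adaptive) probe algorithm with output in `α`, where the non-null
answers to probes lie in `R`: it either stops with an output, or makes a probe `(v, i)` and
continues depending on the answer. -/
inductive Prog (R : Type) (α : Type) : Type
  | ret : α → Prog R α
  | probe : ℕ → ℕ → (Option R → Prog R α) → Prog R α

namespace Prog

variable {R R' α β : Type}

def bind : Prog R α → (α → Prog R β) → Prog R β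
  | ret a, f => f a
  | probe v i c, f => probe v i fun x => (c x).bind f

instance : Monad (Prog R) where
  pure := Prog.ret
  bind := Prog.bind

/-- The output, when probes are answered by `ans`. -/
def run (ans : ℕ → ℕ → Option R) : Prog R α → α
  | ret a => a
  | probe v i c => (c (ans v i)).run ans

/-- The vertices that are probed, when probes are answered by `ans`. -/
def probed (ans : ℕ → ℕ → Option R) : Prog R α → List ℕ
  | ret _ => []
  | probe v i c => v :: (c (ans v i)).probed ans

/-- Replace every probe by a subroutine that computes its answer. -/
def simulate (h : ℕ → ℕ → Prog R' (Option R)) : Prog R α → Prog R' α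
  | ret a => ret a
  | probe v i c => (h v i).bind fun x => (c x).simulate h

/-- Run `f` on all elements of a list and collect the outputs. -/
def collect (f : α → Prog R β) : List α → Prog R (List β)
  | [] => pure []
  | a :: l => do
      let b ← f a
      let bs ← collect f l
      pure (b :: bs)

/-- Run `f` on the elements of a list until one of the answers is `true`. -/
def anyTrue (f : α → Prog R Bool) : List α → Prog R Bool
  | [] => pure false
  | a :: l => do
      let b ← f a
      if b then pure true else anyTrue f l

end Prog

/-! ### Coloring algorithms -/

/-- A probe algorithm for vertex coloring.  Its input: an upper bound `N` on the IDs (all IDs are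
smaller than `N`), an upper bound `D` on the degrees, and the query (a vertex).  Its output: the
color of the queried vertex. -/
abbrev ColoringAlg : Type := ℕ → ℕ → ℕ → Prog (ℕ × ℕ) ℕ

/-- `C` computes a proper vertex coloring with `poly(D)` colors, and its probe radius is
`O(log* N + poly(D))`; the constant and the degrees of the polynomials are given by `A`. -/
def IsColoringAlg (A : ℕ) (C : ColoringAlg) : Prop :=
  ∀ (N D : ℕ) (Γ : LabeledGraph), (∀ v ∈ Γ.verts, v < N) → Γ.maxDeg ≤ D →
    (∀ u v, Γ.graph.Adj u v → (C N D u).run Γ.answer ≠ (C N D v).run Γ.answer) ∧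
    (∀ v ∈ Γ.verts, (C N D v).run Γ.answer < A * (D + 1) ^ A) ∧
    (∀ v ∈ Γ.verts, ∀ x ∈ (C N D v).probed Γ.answer,
      Γ.graph.edist v x ≤ ((A * (logStar N + (D + 1) ^ A) : ℕ) : ℕ∞))

/-! ### Paths, cycles, and augmenting paths -/

/-- The consecutive pairs of a sequence of vertices. -/
def edgeList : List ℕ → List (Sym2 ℕ)
  | a :: b :: l => s(a, b) :: edgeList (b :: l)
  | _ => []

/-- The set `E(p)`. -/
def edgesOf (p : List ℕ) : Finset (Sym2 ℕ) := (edgeList p).toFinset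

/-- `p` is the vertex sequence of a simple path of positive length.  Of the two traversals of an
undirected path, the one that starts at the smaller endpoint represents it. -/
def IsSimplePath (p : List ℕ) : Prop :=
  2 ≤ p.length ∧ p.Nodup ∧ p.headD 0 < p.getLastD 0

/-- `p` is the closed vertex sequence `v₀, …, v_{ℓ-1}, v₀` of a simple cycle.  Of all the
traversals of an undirected cycle, the one that starts at the smallest vertex, and proceeds towards
the smaller of its two neighbors on the cycle, represents it. -/
def IsSimpleCycle (p : List ℕ) : Prop :=
  4 ≤ p.length ∧ p.tail.Nodup ∧ p.headD 0 = p.getLastD 0 ∧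
    (∀ x ∈ p, p.headD 0 ≤ x) ∧ p.getD 1 0 < p.getD (p.length - 2) 0

/-- `p` is a simple path or a simple cycle, all of whose edges are in `E`. -/
def IsPathOrCycle (E : Finset (Sym2 ℕ)) (p : List ℕ) : Prop :=
  (IsSimplePath p ∨ IsSimpleCycle p) ∧ edgesOf p ⊆ E

/-- No two distinct edges of `M` share an endpoint. -/
def IsMatchingSet (M : Finset (Sym2 ℕ)) : Prop :=
  ∀ e ∈ M, ∀ f ∈ M, e ≠ f → ∀ x, ¬ (x ∈ e ∧ x ∈ f)

/-- The gain `w(p \ M) - w(p ∩ M)`. -/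
noncomputable def gain (w : Sym2 ℕ → ℝ) (M : Finset (Sym2 ℕ)) (p : List ℕ) : ℝ :=
  ∑ e ∈ edgesOf p \ M, w e - ∑ e ∈ edgesOf p ∩ M, w e

/-- `p` is an `(M,[1,k])`-augmenting path (or cycle) with gain `g`, with respect to the edge set
`E`, the weights `w` and the matching `M`. -/
def IsAugmenting (E : Finset (Sym2 ℕ)) (w : Sym2 ℕ → ℝ) (M : Finset (Sym2 ℕ)) (k : ℕ) (g : ℝ)
    (p : List ℕ) : Prop :=
  IsPathOrCycle E p ∧
  (edgeList p).IsChain (fun e f => e ∈ M ↔ f ∉ M) ∧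
  IsMatchingSet (symmDiff M (edgesOf p)) ∧
  0 < gain w M p ∧
  (edgesOf p \ M).card ≤ k ∧
  gain w M p = g

/-- All sequences of at most `m` numbers smaller than `B`, in lexicographic order. -/
def seqs (B : ℕ) : ℕ → List (List ℕ)
  | 0 => [[]]
  | m + 1 => [] :: (List.range B).flatMap fun x => (seqs B m).map fun p => x :: p

/-! ### The oracles -/

/-- What the algorithm knows besides the answers to its probes: the maximum degree `Δ`, a number
`B` such that all IDs are smaller than `B`, the parameter `k`, and the coloring algorithm that it
uses as a subroutine. -/
structure OracleInput where
  Δ : ℕ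
  B : ℕ
  k : ℕ
  C : ColoringAlg

namespace OracleInput

/-- Probe algorithms for the edge-weighted graph `G`. -/
abbrev WProg (α : Type) : Type := Prog (ℕ × ℕ × ℝ) α

/-- Find all the neighbors of `v`, with the weights of the edges to them. -/
def neighbors (P : OracleInput) (v : ℕ) : WProg (List (ℕ × ℝ)) := do
  let l ← Prog.collect (fun i => Prog.probe v i Prog.ret) (List.range P.Δ)
  pure (l.filterMap fun o => o.map fun t => (t.1, t.2.2))

/-- BFS: find the vertices of the balls of radius `d` that are centered at the vertices of `S`. -/
def bfs (P : OracleInput) : ℕ → List ℕ → WProg (List ℕ)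
  | 0, S => pure S
  | d + 1, S => do
      let nb ← Prog.collect P.neighbors S
      P.bfs d (S ++ nb.flatten.map Prod.fst).dedup

/-- Find all the edges (with their weights) of the subgraph of `G` that is induced by the union of
the balls of radius `d` centered at the vertices of `S`.  An edge `{a, b}` with `a < b` and weight
`x` is returned as `(a, b, x)`. -/
def ballEdges (P : OracleInput) (d : ℕ) (S : List ℕ) : WProg (List (ℕ × ℕ × ℝ)) := do
  let U ← P.bfs d S
  let l ← Prog.collect (fun a => do
    let nb ← P.neighbors a
    pure ((nb.filter fun t => a < t.1 ∧ t.1 ∈ U).map fun t => (a, t.1, t.2))) U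
  pure l.flatten

/-- The edge set of a list of weighted edges. -/
def edgesIn (F : List (ℕ × ℕ × ℝ)) : Finset (Sym2 ℕ) :=
  (F.map fun t => s(t.1, t.2.1)).toFinset

/-- The weight of an edge according to a list of weighted edges. -/
def weightIn (F : List (ℕ × ℕ × ℝ)) (e : Sym2 ℕ) : ℝ :=
  ((F.find? fun t => s(t.1, t.2.1) = e).map fun t => t.2.2).getD 0

/-- The edges of `F` to which the oracle `O` answers `true`. -/
def matchedEdges (O : ℕ → ℕ → WProg Bool) : List (ℕ × ℕ × ℝ) → WProg (Finset (Sym2 ℕ))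
  | [] => pure ∅
  | t :: F => do
      let χ ← O t.1 t.2.1
      let M ← matchedEdges O F
      pure (if χ then insert s(t.1, t.2.1) M else M)

/-- The candidates for vertex sequences of paths and cycles with at most `2k+1` edges. -/
def candidates (P : OracleInput) : List (List ℕ) := seqs P.B (2 * P.k + 2)

open Classical in
/-- The intersection graph `G_k` has as vertices the paths and cycles with at most `2k+1` edges in
`G`; two of them are adjacent if they share a vertex.  This procedure lists the neighbors of `p` in
`G_k`, in lexicographic order. -/
noncomputable def probeGk (P : OracleInput) (p : List ℕ) : WProg (List (List ℕ)) := do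
  let l ← Prog.collect (fun v => do
    let F ← P.ballEdges (2 * P.k + 1) [v]
    pure (P.candidates.filter fun q => IsPathOrCycle (edgesIn F) q ∧ v ∈ q)) p
  pure (P.candidates.filter fun q => q ≠ p ∧ q ∈ l.flatten)

/-- The ID of a vertex of `G_k` is the rank of its vertex sequence in the list of candidates.  This
is the simulation in `G` of the probe `(c, i)` in `G_k`, where `c` is such an ID. -/
noncomputable def simProbeGk (P : OracleInput) (c i : ℕ) : WProg (Option (ℕ × ℕ)) :=
  match P.candidates[c]? with
  | none => pure none
  | some p => do
      let nb ← P.probeGk p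
      match nb[i]? with
      | none => pure none
      | some q => do
          let nb' ← P.probeGk q
          pure (some (P.candidates.idxOf q, nb'.idxOf p))

/-- The color of `p` in the coloring of `G_k` that is computed by the coloring algorithm.  All IDs
in `G_k` are smaller than the number of candidates, and all degrees in `G_k` are bounded by
`(2k+2)^3 Δ^(2k+1)`. -/
noncomputable def color (P : OracleInput) (p : List ℕ) : WProg ℕ :=
  (P.C P.candidates.length ((2 * P.k + 2) ^ 3 * P.Δ ^ (2 * P.k + 1))
    (P.candidates.idxOf p)).simulate P.simProbeGk

open Classical in
/-- `probe(i,j,p)`: given the oracle `O` of the previous matching `M`, list the neighbors of `p` in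
the intersection graph `H` of the `(M,[1,k])`-augmenting paths with gain `g`. -/
noncomputable def probeH (P : OracleInput) (O : ℕ → ℕ → WProg Bool) (g : ℝ) (p : List ℕ) :
    WProg (List (List ℕ)) := do
  let l ← Prog.collect (fun v => do
    let F ← P.ballEdges (2 * P.k + 1) [v]
    let M ← matchedEdges O F
    pure (P.candidates.filter fun q =>
      IsAugmenting (edgesIn F) (weightIn F) M P.k g q ∧ v ∈ q)) p
  pure (P.candidates.filter fun q => q ≠ p ∧ q ∈ l.flatten)

/-- The DFS of the MIS-algorithm over `H`, for a vertex `p` of color at most `c`.  Edges are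
directed from high color to low color, and `p` is in the MIS if none of the neighbors to which it
has an outgoing edge is in the MIS. -/
noncomputable def misDFS (P : OracleInput) (O : ℕ → ℕ → WProg Bool) (g : ℝ) :
    ℕ → List ℕ → WProg Bool
  | 0, _ => pure true
  | c + 1, p => do
      let cp ← P.color p
      let nb ← P.probeH O g p
      let b ← Prog.anyTrue (fun q => do
        let cq ← P.color q
        if cq < cp then misDFS P O g c q else pure false) nb
      pure (!b)

/-- The MIS-algorithm over `H`: is `p` in the maximal independent set? -/
noncomputable def lmis (P : OracleInput) (O : ℕ → ℕ → WProg Bool) (g : ℝ) (p : List ℕ) :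
    WProg Bool := do
  let c ← P.color p
  P.misDFS O g c p

open Classical in
/-- The procedure `A_{i,j}`, for the gain `g = g_j`, where `O` is the oracle of the previous
matching. -/
noncomputable def procA (P : OracleInput) (O : ℕ → ℕ → WProg Bool) (g : ℝ) (u v : ℕ) :
    WProg Bool := do
  let F ← P.ballEdges (2 * P.k) [u, v]
  let M ← matchedEdges O F
  Prog.anyTrue (P.lmis O g) (P.candidates.filter fun p =>
    IsAugmenting (edgesIn F) (weightIn F) M P.k g p ∧ s(u, v) ∈ edgesOf p)

/-- The oracle of the next matching, given the oracle `O` of the previous matching. -/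
noncomputable def step (P : OracleInput) (O : ℕ → ℕ → WProg Bool) (g : ℝ) (u v : ℕ) :
    WProg Bool := do
  let τ ← O u v
  let ρ ← P.procA O g u v
  pure (xor τ ρ)

/-- The oracle after processing a list of gains, one after the other. -/
noncomputable def sweep (P : OracleInput) (gains : List ℝ) (O : ℕ → ℕ → WProg Bool) :
    ℕ → ℕ → WProg Bool :=
  gains.foldl P.step O

/-- The oracle `O_{i,j}`, for `i ≥ 1` and `0 ≤ j ≤ T`, where `gains = [g_1, …, g_T]`: it starts from
the empty matching, makes `i - 1` full sweeps over the gains, and then processes `g_1, …, g_j`.  Its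
input is an edge, given by its endpoints. -/
noncomputable def oracle (P : OracleInput) (gains : List ℝ) (i j : ℕ) : ℕ → ℕ → WProg Bool :=
  P.sweep (gains.take j) ((P.sweep gains)^[i - 1] fun _ _ => pure false)

end OracleInput

/-- The probe radius of an algorithm `O` for edge queries in the weighted graph `(G, w)` is at most
`r`: all the probes that it makes on a query are at distance at most `r` from the queried edge. -/
def ProbeRadiusLE (G : LabeledGraph) (w : Sym2 ℕ → ℝ)
    (O : ℕ → ℕ → Prog (ℕ × ℕ × ℝ) Bool) (r : ℕ) : Prop :=
  ∀ u v, G.graph.Adj u v → ∀ x ∈ (O u v).probed (G.wanswer w),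
    G.graph.edist u x ≤ r ∨ G.graph.edist v x ≤ r

/-! ### Weights and gains -/

/-- `w_min(ε) = max {ε/n, min_e w(e)}`. -/
noncomputable def wmin (ε : ℝ) (G : LabeledGraph) (w : Sym2 ℕ → ℝ) : ℝ :=
  max (ε / G.order) (sInf (w '' G.graph.edgeSet))

/-- The integer powers of `β` in the interval `[x, 1]`, for `0 < β < 1` and `0 < x ≤ 1`. -/
noncomputable def weightValues (β x : ℝ) : Finset ℝ :=
  (Finset.range (⌊Real.logb β x⌋₊ + 1)).image fun z => β ^ z

/-- The sums of `m` (not necessarily distinct) elements of `S`. -/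
noncomputable def sumsOf (S : Finset ℝ) (m : ℕ) : Finset ℝ :=
  (S.sym m).image fun t : Sym ℝ m => (t : Multiset ℝ).sum

/-- All possible gains of `(M,[1,k])`-augmenting paths whose edges have weights in `S`: the positive
numbers `w(p \ M) - w(p ∩ M)`, where `p \ M` has at most `k` edges and `p ∩ M` has at most `k + 1`
edges. -/
noncomputable def possibleGains (k : ℕ) (S : Finset ℝ) : Finset ℝ :=
  ((Finset.range (k + 1)).biUnion fun a => (Finset.range (k + 2)).biUnion fun b =>
    (sumsOf S a ×ˢ sumsOf S b).image fun t => t.1 - t.2).filter fun x => 0 < x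

/-- The possible gains in decreasing order `g_1 > g_2 > … > g_T`. -/
noncomputable def gainList (k : ℕ) (S : Finset ℝ) : List ℝ :=
  (possibleGains k S).sort (· ≥ ·)

/-! The probe radius is additive along the chain of oracles. A call of the previous oracle, of
radius `r`, is made only on an edge lying within some distance `s` of the query, so it probes within
`s + r`; calls made at different places do not accumulate. It remains to bound `s` for one step,
uniformly in the step, and to multiply by the number `L * T` of steps.

Bound for one step. A vertex of `G_k` has at most `2k+1` edges, so a step from a path to an
intersecting one moves by at most `2k+1` in `G`. The DFS for the independent set descends at most as
many levels as there are colors, and each color costs `2k+1` times the radius of the coloring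
algorithm on `G_k`, plus a constant number of balls. This gives `stepRadius`
(`near_of_mem_probed_misDFS`, `probeRadiusLE_step`). The degree of `G_k` is at most `(2k+2)^3
Δ^(2k+1)`, by guessing port by port a walk through a common vertex, and its IDs are polynomial in
`n` with exponent `O(k)`, which changes `log*` only by an additive `O(k)`. Hence one step costs
`2^O(k) (log* n + Δ^O(k))` (`stepRadius_le`). None of this uses that the oracles accept matchings or
that the independent set is correct.

Number of steps. `L` is at most `2^O(k)`. A gain is a difference of two sums of at most `k+1` terms
out of `O(kℓ)` weights. Counting multisets instead of sequences divides by `m!`, and `k^m / m! ≤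
e^k` removes every factor `1/ε` from the base, leaving `ℓ^O(k)` gains (`card_possibleGains_le`). For
an arbitrary list the base is `ℓ/ε`. Finally `k ≤ 4/ε` turns all exponents into `O(1/ε)`.

Coloring algorithms exist by Linial's color reduction with polynomials over prime fields. -/

/-! ### Outputs and probes of composed programs -/

namespace Prog

variable {R R' α β : Type} {ans : ℕ → ℕ → Option R}

@[simp] theorem run_pure (a : α) : (pure a : Prog R α).run ans = a := rfl

@[simp] theorem run_ret (a : α) : (ret a : Prog R α).run ans = a := rfl

@[simp] theorem probed_pure (a : α) : (pure a : Prog R α).probed ans = [] := rfl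

@[simp] theorem probed_ret (a : α) : (ret a : Prog R α).probed ans = [] := rfl

@[simp] theorem run_probe (v i : ℕ) (c : Option R → Prog R α) :
    (probe v i c).run ans = (c (ans v i)).run ans := rfl

@[simp] theorem probed_probe (v i : ℕ) (c : Option R → Prog R α) :
    (probe v i c).probed ans = v :: (c (ans v i)).probed ans := rfl

@[simp] theorem run_bind (x : Prog R α) (f : α → Prog R β) :
    (x >>= f).run ans = (f (x.run ans)).run ans := by
  induction x with
  | ret a => rfl
  | probe v i c ih => exact ih (ans v i)

@[simp] theorem probed_bind (x : Prog R α) (f : α → Prog R β) :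
    (x >>= f).probed ans = x.probed ans ++ (f (x.run ans)).probed ans := by
  induction x with
  | ret a => rfl
  | probe v i c ih => exact congrArg (v :: ·) (ih (ans v i))

@[simp] theorem run_collect (f : α → Prog R β) (l : List α) :
    (collect f l).run ans = l.map fun a => (f a).run ans := by
  induction l with
  | nil => rfl
  | cons a l ih => simp [collect, ih]

@[simp] theorem mem_probed_collect (f : α → Prog R β) (l : List α) (x : ℕ) :
    x ∈ (collect f l).probed ans ↔ ∃ a ∈ l, x ∈ (f a).probed ans := by
  induction l with
  | nil => simp [collect]
  | cons a l ih => simp [collect, ih]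

theorem exists_of_mem_probed_anyTrue {f : α → Prog R Bool} {l : List α} {x : ℕ}
    (h : x ∈ (anyTrue f l).probed ans) : ∃ a ∈ l, x ∈ (f a).probed ans := by
  induction l with
  | nil => simp [anyTrue] at h
  | cons a l ih =>
    simp only [anyTrue, probed_bind, List.mem_append] at h
    rcases h with h | h
    · exact ⟨a, by simp, h⟩
    · split at h
      · simp at h
      · obtain ⟨b, hb, hx⟩ := ih h
        exact ⟨b, by simp [hb], hx⟩

/-- A simulation is correct if the subroutine is correct on all the probes that are made. -/
theorem run_simulate {ans' : ℕ → ℕ → Option R'} {h : ℕ → ℕ → Prog R' (Option R)}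
    (p : Prog R α) (hp : ∀ v ∈ p.probed ans, ∀ i, (h v i).run ans' = ans v i) :
    (p.simulate h).run ans' = p.run ans := by
  induction p with
  | ret a => rfl
  | probe v i c ih =>
    change (h v i >>= fun x => (c x).simulate h).run ans' = _
    rw [run_bind, hp v (by simp) i, run_probe]
    exact ih _ fun x hx => hp x (by simp [hx])

/-- Correctness of the subroutine is demanded only at the vertices actually probed: the simulation
of `G_k` is wrong at IDs of candidates that are not paths or cycles of `G`. -/
theorem exists_of_mem_probed_simulate {ans' : ℕ → ℕ → Option R'}
    {h : ℕ → ℕ → Prog R' (Option R)}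
    (p : Prog R α) (hp : ∀ v ∈ p.probed ans, ∀ i, (h v i).run ans' = ans v i) {x : ℕ}
    (hx : x ∈ (p.simulate h).probed ans') :
    ∃ v ∈ p.probed ans, ∃ i, x ∈ (h v i).probed ans' := by
  induction p with
  | ret a => exact absurd hx (by simp [simulate])
  | probe v i c ih =>
    change x ∈ (h v i >>= fun x => (c x).simulate h).probed ans' at hx
    rw [probed_bind, List.mem_append, hp v (by simp) i] at hx
    rcases hx with hx | hx
    · exact ⟨v, by simp, i, hx⟩
    · obtain ⟨u, hu, j, hj⟩ := ih _ (fun y hy => hp y (by simp [hy])) hx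
      exact ⟨u, by simp [hu], j, hj⟩

end Prog

/-! ### Distances to a set of vertices -/

/-- `x` is at distance at most `d` from a vertex in `S`. -/
def Near (G : SimpleGraph ℕ) (S : Set ℕ) (d x : ℕ) : Prop :=
  ∃ s ∈ S, ∃ p : G.Walk s x, p.length ≤ d

namespace Near

variable {G : SimpleGraph ℕ} {S T : Set ℕ} {d d' x y : ℕ}

theorem of_mem (h : x ∈ S) : Near G S d x := ⟨x, h, .nil, by simp⟩

theorem mono (h : Near G S d x) (hd : d ≤ d') : Near G S d' x := by
  obtain ⟨s, hs, p, hp⟩ := h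
  exact ⟨s, hs, p, hp.trans hd⟩

theorem append (h : Near G S d x) (p : G.Walk x y) : Near G S (d + p.length) y := by
  obtain ⟨s, hs, q, hq⟩ := h
  exact ⟨s, hs, q.append p, by simpa using hq⟩

theorem trans (hT : ∀ t ∈ T, Near G S d t) (h : Near G T d' x) : Near G S (d + d') x := by
  obtain ⟨t, ht, p, hp⟩ := h
  exact ((hT t ht).append p).mono (by omega)

theorem adj (h : Near G S d x) (hxy : G.Adj x y) : Near G S (d + 1) y :=
  h.append (.cons hxy .nil)

end Near

namespace LabeledGraph

variable (G : LabeledGraph)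

theorem length_ports_le (v : ℕ) : (G.ports v).length ≤ G.maxDeg := by
  by_cases hv : v ∈ G.verts
  · exact Finset.le_sup (f := fun v => (G.ports v).length) hv
  · have : G.ports v = [] := List.eq_nil_iff_forall_not_mem.2 fun u hu =>
      hv (G.mem_verts v u ((G.mem_ports v u).1 hu))
    simp [this]

/-- The probes to all ports up to the maximum degree reveal all the ports. -/
theorem filterMap_range_ports {γ : Type} (f : ℕ → γ) {m : ℕ} (v : ℕ) (hm : G.maxDeg ≤ m) :
    ((List.range m).filterMap fun i => (G.ports v)[i]?.map f) = (G.ports v).map f := by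
  have key : ∀ (l : List ℕ) (m : ℕ), l.length ≤ m →
      ((List.range m).filterMap fun i => l[i]?.map f) = l.map f := by
    intro l
    induction l with
    | nil => intro m _; simp
    | cons a l ih =>
      intro m hm
      obtain ⟨m, rfl⟩ : ∃ m', m = m' + 1 := ⟨m - 1, by simp at hm; omega⟩
      rw [List.range_succ_eq_map, List.filterMap_cons]
      simp only [List.getElem?_cons_zero, Option.map_some, List.filterMap_map, List.map_cons,
        List.cons.injEq, true_and]
      exact ih m (by simpa using hm)
  exact key _ _ ((G.length_ports_le v).trans hm)

end LabeledGraph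

/-! ### Exploration of balls -/

/-- The maximum degree and the bound on the IDs that are known to the algorithm are correct. -/
structure OracleInput.Fits (P : OracleInput) (G : LabeledGraph) : Prop where
  deg : P.Δ = G.maxDeg
  ids : ∀ v ∈ G.verts, v < P.B

namespace OracleInput

variable {P : OracleInput} {G : LabeledGraph} {w : Sym2 ℕ → ℝ}

theorem run_neighbors (h : P.Fits G) (v : ℕ) :
    (P.neighbors v).run (G.wanswer w) = (G.ports v).map fun u => (u, w s(v, u)) := by
  have := G.filterMap_range_ports (fun u => (u, w s(v, u))) v h.deg.ge
  rw [← this]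
  simp [neighbors, LabeledGraph.wanswer, List.filterMap_map, Function.comp_def]

theorem eq_of_mem_probed_neighbors {v x : ℕ}
    (hx : x ∈ (P.neighbors v).probed (G.wanswer w)) : x = v := by
  simp [neighbors] at hx
  exact hx.2

theorem mem_run_bfs (h : P.Fits G) (d : ℕ) (S : List ℕ) (x : ℕ) :
    x ∈ (P.bfs d S).run (G.wanswer w) ↔ Near G.graph {s | s ∈ S} d x := by
  induction d generalizing S with
  | zero =>
    constructor
    · exact fun hx => Near.of_mem hx
    · rintro ⟨s, hs, p, hp⟩
      cases p with
      | nil => exact hs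
      | cons => simp at hp
  | succ d ih =>
    simp only [bfs, Prog.run_bind, Prog.run_collect, run_neighbors h, ih]
    constructor
    · intro hx
      rw [add_comm]
      refine Near.trans (fun t ht => ?_) hx
      simp only [Set.mem_ofPred_eq, List.mem_dedup, List.mem_append, List.mem_map,
        List.mem_flatten] at ht
      rcases ht with ht | ⟨a, ⟨_, ⟨s, hs, rfl⟩, ha⟩, rfl⟩
      · exact Near.of_mem ht
      · obtain ⟨u, hu, rfl⟩ := List.mem_map.1 ha
        exact (Near.of_mem (d := 0) (S := {s | s ∈ S}) hs).adj ((G.mem_ports _ _).1 hu)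
    · rintro ⟨s, hs, p, hp⟩
      cases p with
      | nil => exact Near.of_mem (by simp; exact .inl hs)
      | @cons _ u _ hu p =>
        refine ⟨u, ?_, p, by simpa using hp⟩
        simp only [Set.mem_ofPred_eq, List.mem_dedup, List.mem_append, List.mem_map,
          List.mem_flatten]
        exact .inr ⟨(u, w s(s, u)), ⟨_, ⟨s, hs, rfl⟩,
          List.mem_map.2 ⟨u, (G.mem_ports _ _).2 hu, rfl⟩⟩, rfl⟩

theorem near_of_mem_probed_bfs (h : P.Fits G) (d : ℕ) (S : List ℕ) {x : ℕ}
    (hx : x ∈ (P.bfs d S).probed (G.wanswer w)) : Near G.graph {s | s ∈ S} d x := by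
  induction d generalizing S with
  | zero => simp [bfs] at hx
  | succ d ih =>
    simp only [bfs, Prog.probed_bind, List.mem_append, Prog.mem_probed_collect] at hx
    rcases hx with ⟨a, ha, hx⟩ | hx
    · rw [eq_of_mem_probed_neighbors hx]
      exact Near.of_mem ha
    · have := ih _ hx
      rw [add_comm]
      refine Near.trans (fun t ht => ?_) this
      -- The new seed list is the output of a BFS of depth one, hence lies within distance one of
      -- `S`.
      rw [← zero_add 1, ← mem_run_bfs (w := w) h (0 + 1) S]
      simpa [bfs] using ht

theorem mem_run_ballEdges (h : P.Fits G) (d : ℕ) (S : List ℕ) (t : ℕ × ℕ × ℝ) :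
    t ∈ (P.ballEdges d S).run (G.wanswer w) ↔
      Near G.graph {s | s ∈ S} d t.1 ∧ Near G.graph {s | s ∈ S} d t.2.1 ∧ t.1 < t.2.1 ∧
        G.graph.Adj t.1 t.2.1 ∧ t.2.2 = w s(t.1, t.2.1) := by
  obtain ⟨a, b, x⟩ := t
  simp only [ballEdges, Prog.run_bind, Prog.run_collect, run_neighbors h, Prog.run_pure,
    List.mem_flatten, List.mem_map, ← mem_run_bfs (w := w) h, List.filter_map]
  constructor
  · rintro ⟨_, ⟨a', ha', rfl⟩, hl⟩
    simp only [List.mem_map, List.mem_filter, Function.comp] at hl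
    obtain ⟨_, ⟨u, ⟨hu, hd⟩, rfl⟩, he⟩ := hl
    simp only [Prod.mk.injEq] at he
    obtain ⟨rfl, rfl, rfl⟩ := he
    have := of_decide_eq_true hd
    exact ⟨ha', this.2, this.1, (G.mem_ports _ _).1 hu, rfl⟩
  · rintro ⟨ha, hb, hab, hadj, hx⟩
    refine ⟨_, ⟨a, ha, rfl⟩, ?_⟩
    simp only [List.mem_map, List.mem_filter, Function.comp]
    exact ⟨_, ⟨b, ⟨(G.mem_ports _ _).2 hadj, decide_eq_true ⟨hab, hb⟩⟩, rfl⟩, by simp_all⟩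

theorem near_of_mem_probed_ballEdges (h : P.Fits G) (d : ℕ) (S : List ℕ) {x : ℕ}
    (hx : x ∈ (P.ballEdges d S).probed (G.wanswer w)) : Near G.graph {s | s ∈ S} d x := by
  simp only [ballEdges, Prog.probed_bind, List.mem_append, Prog.mem_probed_collect,
    Prog.probed_pure, List.not_mem_nil, or_false] at hx
  rcases hx with hx | ⟨a, ha, hx⟩
  · exact near_of_mem_probed_bfs h d S hx
  · rw [eq_of_mem_probed_neighbors hx]
    exact (mem_run_bfs h d S a).1 ha

theorem mem_edgesIn_run_ballEdges (h : P.Fits G) (d : ℕ) (S : List ℕ) (a b : ℕ) :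
    s(a, b) ∈ edgesIn ((P.ballEdges d S).run (G.wanswer w)) ↔
      G.graph.Adj a b ∧ Near G.graph {s | s ∈ S} d a ∧ Near G.graph {s | s ∈ S} d b := by
  simp only [edgesIn, List.mem_toFinset, List.mem_map, mem_run_ballEdges h]
  constructor
  · rintro ⟨⟨c, e, x⟩, ⟨hc, he, -, hadj, -⟩, heq⟩
    rcases Sym2.eq_iff.1 heq with ⟨rfl, rfl⟩ | ⟨rfl, rfl⟩
    · exact ⟨hadj, hc, he⟩
    · exact ⟨hadj.symm, he, hc⟩
  · rintro ⟨hadj, ha, hb⟩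
    rcases lt_or_gt_of_ne hadj.ne with hlt | hlt
    · exact ⟨(a, b, w s(a, b)), ⟨ha, hb, hlt, hadj, rfl⟩, rfl⟩
    · exact ⟨(b, a, w s(b, a)), ⟨hb, ha, hlt, hadj.symm, rfl⟩, Sym2.eq_swap⟩

theorem exists_of_mem_probed_matchedEdges {O : ℕ → ℕ → WProg Bool} {F : List (ℕ × ℕ × ℝ)}
    {ans : ℕ → ℕ → Option (ℕ × ℕ × ℝ)} {x : ℕ} (hx : x ∈ (matchedEdges O F).probed ans) :
    ∃ t ∈ F, x ∈ (O t.1 t.2.1).probed ans := by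
  induction F with
  | nil => simp [matchedEdges] at hx
  | cons t F ih =>
    simp only [matchedEdges, Prog.probed_bind, List.mem_append, Prog.probed_pure,
      List.not_mem_nil, or_false] at hx
    rcases hx with hx | hx
    · exact ⟨t, by simp, hx⟩
    · obtain ⟨t', ht', hx⟩ := ih hx
      exact ⟨t', by simp [ht'], hx⟩

end OracleInput

/-! ### Vertex sequences -/

theorem mem_seqs {B m : ℕ} {p : List ℕ} : p ∈ seqs B m ↔ p.length ≤ m ∧ ∀ x ∈ p, x < B := by
  induction m generalizing p with
  | zero => cases p <;> simp [seqs]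
  | succ m ih =>
    cases p with
    | nil => simp [seqs]
    | cons x p =>
      simp only [seqs, List.mem_cons, reduceCtorEq, List.mem_flatMap, List.mem_range,
        List.mem_map, ih, List.cons.injEq, false_or, List.length_cons]
      constructor
      · rintro ⟨y, hy, q, ⟨hq, hq'⟩, rfl, rfl⟩
        exact ⟨by omega, by simpa [hy] using hq'⟩
      · rintro ⟨h, h'⟩
        exact ⟨x, h' x (.inl rfl), p, ⟨by omega, fun z hz => h' z (.inr hz)⟩, rfl, rfl⟩

/-- Makes the rank of a candidate a faithful ID, and makes lengths of filtered lists count paths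
without repetition. -/
theorem nodup_seqs (B m : ℕ) : (seqs B m).Nodup := by
  induction m with
  | zero => simp [seqs]
  | succ m ih =>
    refine List.nodup_cons.2 ⟨by simp, List.nodup_flatMap.2 ⟨fun x _ => ?_, ?_⟩⟩
    · exact ih.map fun p q h => (List.cons.inj h).2
    · refine List.nodup_range.imp fun {x y} hxy => ?_
      rw [Function.onFun, List.disjoint_left]
      rintro p hp hq
      obtain ⟨p', -, rfl⟩ := List.mem_map.1 hp
      obtain ⟨q', -, hq⟩ := List.mem_map.1 hq
      exact hxy (List.cons.inj hq).1.symm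

theorem length_seqs_le (B m : ℕ) : (seqs B m).length ≤ (B + 1) ^ m := by
  induction m with
  | zero => simp [seqs]
  | succ m ih =>
    have h1 : 1 ≤ (B + 1) ^ m := Nat.one_le_pow _ _ (by omega)
    simp only [seqs, List.length_cons, List.length_flatMap, List.length_map, List.map_const',
      List.length_range, List.sum_replicate, smul_eq_mul, pow_succ]
    nlinarith [Nat.mul_le_mul_left B ih]

theorem edgesOf_cons_cons (a b : ℕ) (l : List ℕ) :
    edgesOf (a :: b :: l) = insert s(a, b) (edgesOf (b :: l)) := by
  simp [edgesOf, edgeList]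

theorem isChain_of_edgesOf_subset {G : SimpleGraph ℕ} {E : Finset (Sym2 ℕ)}
    (hE : ∀ a b, s(a, b) ∈ E → G.Adj a b) {p : List ℕ} (hp : edgesOf p ⊆ E) : p.IsChain G.Adj := by
  induction p with
  | nil => simp
  | cons a l ih =>
    cases l with
    | nil => simp
    | cons b l =>
      rw [edgesOf_cons_cons, Finset.insert_subset_iff] at hp
      exact List.isChain_cons_cons.2 ⟨hE _ _ hp.1, ih hp.2⟩

theorem edgesOf_subset_of_isChain {G : SimpleGraph ℕ} {E : Finset (Sym2 ℕ)} {p : List ℕ}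
    (hE : ∀ a ∈ p, ∀ b ∈ p, G.Adj a b → s(a, b) ∈ E) (hp : p.IsChain G.Adj) : edgesOf p ⊆ E := by
  induction p with
  | nil => simp [edgesOf, edgeList]
  | cons a l ih =>
    cases l with
    | nil => simp [edgesOf, edgeList]
    | cons b l =>
      rw [edgesOf_cons_cons, Finset.insert_subset_iff]
      rw [List.isChain_cons_cons] at hp
      exact ⟨hE _ (by simp) _ (by simp) hp.1,
        ih (fun x hx y hy => hE _ (by simp [hx]) _ (by simp [hy])) hp.2⟩

theorem left_mem_of_mem_edgesOf {p : List ℕ} {a b : ℕ} (h : s(a, b) ∈ edgesOf p) : a ∈ p := by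
  induction p with
  | nil => simp [edgesOf, edgeList] at h
  | cons c l ih =>
    cases l with
    | nil => simp [edgesOf, edgeList] at h
    | cons d l =>
      rw [edgesOf_cons_cons, Finset.mem_insert, Sym2.eq_iff] at h
      rcases h with (⟨rfl, -⟩ | ⟨rfl, -⟩) | h
      · simp
      · simp
      · exact List.mem_cons_of_mem _ (ih h)

theorem exists_walk_of_isChain_cons {G : SimpleGraph ℕ} {a : ℕ} {l : List ℕ}
    (h : (a :: l).IsChain G.Adj) {y : ℕ} (hy : y ∈ a :: l) :
    ∃ W : G.Walk a y, W.length ≤ l.length := by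
  induction l generalizing a with
  | nil => obtain rfl : y = a := by simpa using hy
           exact ⟨.nil, by simp⟩
  | cons b l ih =>
    rw [List.isChain_cons_cons] at h
    rcases List.mem_cons.1 hy with rfl | hy
    · exact ⟨.nil, by simp⟩
    · obtain ⟨W, hW⟩ := ih h.2 hy
      exact ⟨.cons h.1 W, by simpa using hW⟩

theorem exists_walk_of_isChain {G : SimpleGraph ℕ} {p : List ℕ} (h : p.IsChain G.Adj) {x y : ℕ}
    (hx : x ∈ p) (hy : y ∈ p) : ∃ W : G.Walk x y, W.length + 1 ≤ p.length := by
  induction p with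
  | nil => simp at hx
  | cons a l ih =>
    rcases List.mem_cons.1 hx with rfl | hx'
    · obtain ⟨W, hW⟩ := exists_walk_of_isChain_cons h hy
      exact ⟨W, by simpa using hW⟩
    · rcases List.mem_cons.1 hy with rfl | hy'
      · obtain ⟨W, hW⟩ := exists_walk_of_isChain_cons h hx
        exact ⟨W.reverse, by simpa using hW⟩
      · obtain ⟨W, hW⟩ := ih h.tail hx' hy'
        exact ⟨W, by simp; omega⟩

namespace List

variable {α β : Type*} [BEq α] [LawfulBEq α] [BEq β] [LawfulBEq β]

/-- Used for the port that points back: replacing paths by their ranks does not change positions in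
a neighbor list. -/
theorem idxOf_map_of_injOn {f : α → β} {s : Set α} (hf : s.InjOn f) {l : List α} {a : α}
    (hl : ∀ x ∈ l, x ∈ s) (ha : a ∈ s) : (l.map f).idxOf (f a) = l.idxOf a := by
  induction l with
  | nil => simp
  | cons b l ih =>
    rw [List.map_cons]
    by_cases hb : b = a
    · subst hb; simp
    · rw [List.idxOf_cons_ne _ hb,
        List.idxOf_cons_ne _ fun h => hb (hf (hl b (by simp)) ha h),
        ih fun x hx => hl x (by simp [hx])]

theorem idxOf_injOn (l : List α) : Set.InjOn (fun a => l.idxOf a) {a | a ∈ l} :=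
  fun _ ha _ _ h => (List.idxOf_inj ha).1 h

end List

/-! ### Counting the sequences through a vertex -/

namespace LabeledGraph

variable (G : LabeledGraph)

/-- The continuations, by `r` further vertices, of a walk that has arrived at `v`. -/
def continuations (v : ℕ) : ℕ → List (List ℕ)
  | 0 => [[]]
  | r + 1 => (G.ports v).flatMap fun u => (continuations u r).map fun l => u :: l

theorem length_continuations_le (v r : ℕ) : (G.continuations v r).length ≤ G.maxDeg ^ r := by
  induction r generalizing v with
  | zero => simp [continuations]
  | succ r ih =>
    simp only [continuations, List.length_flatMap, List.length_map]
    refine (List.sum_le_card_nsmul _ (G.maxDeg ^ r) ?_).trans ?_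
    · intro x hx
      obtain ⟨u, -, rfl⟩ := List.mem_map.1 hx
      exact ih u
    · rw [List.length_map, smul_eq_mul, pow_succ, mul_comm]
      exact Nat.mul_le_mul_left _ (G.length_ports_le v)

theorem mem_continuations {v : ℕ} {l : List ℕ} (h : (v :: l).IsChain G.graph.Adj) :
    l ∈ G.continuations v l.length := by
  induction l generalizing v with
  | nil => simp [continuations]
  | cons u l ih =>
    rw [List.isChain_cons_cons] at h
    exact List.mem_flatMap.2
      ⟨u, (G.mem_ports _ _).2 h.1, List.mem_map.2 ⟨l, ih h.2, rfl⟩⟩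

/-- The walks with `i + j + 1` vertices in which `v` has `i` predecessors. -/
def walksThrough (v i j : ℕ) : List (List ℕ) :=
  (G.continuations v i).flatMap fun l => (G.continuations v j).map fun r => l.reverse ++ v :: r

theorem length_walksThrough_le (v i j : ℕ) :
    (G.walksThrough v i j).length ≤ G.maxDeg ^ (i + j) := by
  simp only [walksThrough, List.length_flatMap, List.length_map, List.map_const',
    List.sum_replicate, smul_eq_mul, pow_add]
  exact Nat.mul_le_mul (G.length_continuations_le _ _) (G.length_continuations_le _ _)

/-- Cutting at an occurrence of `v` leaves two walks that start at `v`, the first one read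
backwards. -/
theorem mem_walksThrough {p : List ℕ} (hp : p.IsChain G.graph.Adj) {v : ℕ} (hv : v ∈ p) :
    ∃ i j, i + j + 1 = p.length ∧ p ∈ G.walksThrough v i j := by
  obtain ⟨l, r, rfl⟩ := List.append_of_mem hv
  refine ⟨l.length, r.length, by simp; omega, List.mem_flatMap.2 ⟨l.reverse, ?_, ?_⟩⟩
  · have h1 : (l ++ [v]).IsChain G.graph.Adj := by
      refine hp.infix ⟨[], r, by simp⟩
    have h2 : (v :: l.reverse).IsChain G.graph.Adj := by
      rw [show v :: l.reverse = (l ++ [v]).reverse by simp, List.isChain_reverse]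
      exact h1.imp fun a b hab => hab.symm
    simpa using G.mem_continuations h2
  · exact List.mem_map.2 ⟨r, G.mem_continuations (hp.infix ⟨l, [], by simp⟩), by simp⟩

/-- The number of walks with at most `m` vertices that meet a given set of at most `m` vertices. -/
theorem length_le_of_forall_meets {m : ℕ} {p : List ℕ} (hp : p.length ≤ m) {Q : List (List ℕ)}
    (hQ : Q.Nodup) (hΔ : 1 ≤ G.maxDeg)
    (h : ∀ q ∈ Q, q.IsChain G.graph.Adj ∧ q.length ≤ m ∧ ∃ v ∈ p, v ∈ q) :
    Q.length ≤ m ^ 3 * G.maxDeg ^ (m - 1) := by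
  -- There are at most `m` choices for each of `v`, `i` and `j`, and then at most `m - 1` vertices
  -- are chosen by their ports; this is the source of `m ^ 3` and of the exponent `m - 1`.
  set W : List (List ℕ) := p.flatMap fun v => (List.range m).flatMap fun i =>
    (List.range m).flatMap fun j => if i + j + 1 ≤ m then G.walksThrough v i j else [] with hW
  have hsub : Q ⊆ W := by
    intro q hq
    obtain ⟨hc, hm, v, hvp, hvq⟩ := h q hq
    obtain ⟨i, j, hij, hmem⟩ := G.mem_walksThrough hc hvq
    refine List.mem_flatMap.2 ⟨v, hvp, List.mem_flatMap.2 ⟨i, List.mem_range.2 (by omega),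
      List.mem_flatMap.2 ⟨j, List.mem_range.2 (by omega), ?_⟩⟩⟩
    rwa [if_pos (by omega)]
  have hlen : ∀ {α : Type} (l : List α) (f : α → List (List ℕ)) (c : ℕ),
      (∀ a ∈ l, (f a).length ≤ c) → (l.flatMap f).length ≤ l.length * c := by
    intro α l f c hc
    rw [List.length_flatMap]
    refine (List.sum_le_card_nsmul _ c ?_).trans (by simp)
    intro x hx
    obtain ⟨a, ha, rfl⟩ := List.mem_map.1 hx
    exact hc a ha
  have hWl : W.length ≤ p.length * (m * (m * G.maxDeg ^ (m - 1))) := by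
    refine hlen _ _ _ fun v _ => ?_
    refine (hlen _ _ (m * G.maxDeg ^ (m - 1)) fun i _ => ?_).trans (by simp)
    refine (hlen _ _ (G.maxDeg ^ (m - 1)) fun j _ => ?_).trans (by simp)
    split
    · exact (G.length_walksThrough_le v i j).trans (Nat.pow_le_pow_right hΔ (by omega))
    · simp
  calc Q.length ≤ W.length := (hQ.subperm hsub).length_le
    _ ≤ p.length * (m * (m * G.maxDeg ^ (m - 1))) := hWl
    _ ≤ m * (m * (m * G.maxDeg ^ (m - 1))) := Nat.mul_le_mul_right _ hp
    _ = _ := by ring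

end LabeledGraph

/-! ### The intersection graph, its simulation and its coloring -/

namespace OracleInput

variable {P : OracleInput} {G : LabeledGraph} {w : Sym2 ℕ → ℝ} {p q : List ℕ}

/-- `p` is a vertex of `G_k`: a simple path or simple cycle with at most `2k+1` edges in `G`. -/
def IsGkVertex (P : OracleInput) (G : LabeledGraph) (p : List ℕ) : Prop :=
  (IsSimplePath p ∨ IsSimpleCycle p) ∧ p.IsChain G.graph.Adj ∧ p ∈ P.candidates

theorem IsGkVertex.length_le (hp : P.IsGkVertex G p) : p.length ≤ 2 * P.k + 2 :=
  (mem_seqs.1 hp.2.2).1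

theorem IsGkVertex.exists_adj (hp : P.IsGkVertex G p) : ∃ a b, G.graph.Adj a b := by
  obtain ⟨h | h, hc, -⟩ := hp
  all_goals
    obtain ⟨h, -⟩ := h
    match p, h, hc with
    | a :: b :: l, _, hc => exact ⟨a, b, (List.isChain_cons_cons.1 hc).1⟩

/-- A sequence with at most `2k+2` entries has diameter at most `2k+1` in `G`; every passage from
one path to another is charged this amount. -/
theorem IsGkVertex.near (hp : P.IsGkVertex G p) {S : Set ℕ} {d v y : ℕ} (hv : v ∈ p) (hy : y ∈ p)
    (h : Near G.graph S d v) : Near G.graph S (d + (2 * P.k + 1)) y := by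
  obtain ⟨W, hW⟩ := exists_walk_of_isChain hp.2.1 hv hy
  exact (h.append W).mono (by have := hp.length_le; omega)

/-- The edges that are found in a ball around `v` suffice to recognize the paths through `v`. -/
theorem isPathOrCycle_ball_iff (h : P.Fits G) {v : ℕ} (hq : q ∈ P.candidates) (hv : v ∈ q) :
    IsPathOrCycle (edgesIn ((P.ballEdges (2 * P.k + 1) [v]).run (G.wanswer w))) q ↔
      P.IsGkVertex G q := by
  constructor
  · rintro ⟨h1, h2⟩
    exact ⟨h1, isChain_of_edgesOf_subset
      (fun a b hab => ((mem_edgesIn_run_ballEdges h _ _ _ _).1 hab).1) h2, hq⟩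
  · intro hG
    have hnear : ∀ a ∈ q, Near G.graph {s | s ∈ [v]} (2 * P.k + 1) a := fun a ha => by
      have := hG.near (S := {s | s ∈ [v]}) (d := 0) hv ha (Near.of_mem (by simp))
      rwa [zero_add] at this
    exact ⟨hG.1, edgesOf_subset_of_isChain (fun _ ha _ hb hab =>
      (mem_edgesIn_run_ballEdges h _ _ _ _).2 ⟨hab, hnear _ ha, hnear _ hb⟩) hG.2.1⟩

theorem isGkVertex_of_isPathOrCycle (h : P.Fits G) {d : ℕ} {S : List ℕ} (hq : q ∈ P.candidates)
    (hp : IsPathOrCycle (edgesIn ((P.ballEdges d S).run (G.wanswer w))) q) :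
    P.IsGkVertex G q :=
  ⟨hp.1, isChain_of_edgesOf_subset
      (fun _ _ hab => ((mem_edgesIn_run_ballEdges h _ _ _ _).1 hab).1) hp.2, hq⟩

open Classical in
/-- The neighbors of `p` in `G_k`. -/
noncomputable def gkNeighbors (P : OracleInput) (G : LabeledGraph) (p : List ℕ) :
    List (List ℕ) :=
  P.candidates.filter fun q => q ≠ p ∧ P.IsGkVertex G q ∧ ∃ v ∈ p, v ∈ q

theorem mem_gkNeighbors :
    q ∈ P.gkNeighbors G p ↔ q ≠ p ∧ P.IsGkVertex G q ∧ ∃ v ∈ p, v ∈ q := by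
  simp only [gkNeighbors, List.mem_filter, decide_eq_true_eq]
  exact ⟨fun h => h.2, fun h => ⟨h.2.1.2.2, h⟩⟩

theorem nodup_gkNeighbors : (P.gkNeighbors G p).Nodup := (nodup_seqs _ _).filter _

/-- A path that meets `p` is recognized from the ball around a common vertex. Both sides filter the
same list, so they agree in order too, which the port numbers require. -/
theorem run_probeGk (h : P.Fits G) : (P.probeGk p).run (G.wanswer w) = P.gkNeighbors G p := by
  simp only [probeGk, Prog.run_bind, Prog.run_collect, Prog.run_pure, gkNeighbors]
  refine List.filter_congr fun q hq => ?_
  rw [decide_eq_decide]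
  refine and_congr_right fun _ => ?_
  simp only [List.mem_flatten, List.mem_map]
  constructor
  · rintro ⟨_, ⟨v, hv, rfl⟩, hm⟩
    simp only [List.mem_filter, decide_eq_true_eq] at hm
    exact ⟨(isPathOrCycle_ball_iff h hq hm.2.2).1 hm.2.1, v, hv, hm.2.2⟩
  · rintro ⟨hG, v, hv, hvq⟩
    refine ⟨_, ⟨v, hv, rfl⟩, ?_⟩
    simp only [List.mem_filter, decide_eq_true_eq]
    exact ⟨hq, (isPathOrCycle_ball_iff h hq hvq).2 hG, hvq⟩

theorem near_of_mem_probed_probeGk (h : P.Fits G) {S : Set ℕ} {d x : ℕ}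
    (hp : ∀ y ∈ p, Near G.graph S d y) (hx : x ∈ (P.probeGk p).probed (G.wanswer w)) :
    Near G.graph S (d + (2 * P.k + 1)) x := by
  simp only [probeGk, Prog.probed_bind, List.mem_append, Prog.mem_probed_collect,
    Prog.probed_pure, List.not_mem_nil, or_false] at hx
  obtain ⟨v, hv, hx⟩ := hx
  exact Near.trans (by simpa using hp v hv) (near_of_mem_probed_ballEdges h _ _ hx)

open Classical in
/-- The labeled graph `G_k`; the ID of `p` is its rank in the list of candidates. -/
noncomputable def gk (P : OracleInput) (G : LabeledGraph) : LabeledGraph where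
  graph :=
    { Adj := fun c d => ∃ p q, P.IsGkVertex G p ∧ q ∈ P.gkNeighbors G p ∧
        c = P.candidates.idxOf p ∧ d = P.candidates.idxOf q
      symm := ⟨fun c d ⟨p, q, hp, hq, hc, hd⟩ => by
        rw [mem_gkNeighbors] at hq
        obtain ⟨hne, hG, v, hv, hv'⟩ := hq
        exact ⟨q, p, hG, mem_gkNeighbors.2 ⟨hne.symm, hp, v, hv', hv⟩, hd, hc⟩⟩
      loopless := ⟨fun c ⟨p, q, hp, hq, hc, hd⟩ => by
        rw [mem_gkNeighbors] at hq
        exact hq.1 ((List.idxOf_inj hq.2.1.2.2).1 (hd.symm.trans hc))⟩ }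
  verts := (P.candidates.toFinset.filter (P.IsGkVertex G)).image P.candidates.idxOf
  ports c := match P.candidates[c]? with
    | none => []
    | some p => if P.IsGkVertex G p then (P.gkNeighbors G p).map P.candidates.idxOf else []
  mem_verts := fun c d ⟨p, q, hp, _, hc, _⟩ =>
    Finset.mem_image.2 ⟨p, by simpa using ⟨hp.2.2, hp⟩, hc.symm⟩
  mem_ports c d := by
    constructor
    · intro h
      split at h
      · simp at h
      · rename_i p hp
        split at h
        · rename_i hG
          obtain ⟨q, hq, rfl⟩ := List.mem_map.1 h
          obtain ⟨hc, rfl⟩ := List.getElem?_eq_some_iff.1 hp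
          exact ⟨_, q, hG, hq, ((nodup_seqs _ _).idxOf_getElem _ _).symm, rfl⟩
        · simp at h
    · rintro ⟨p, q, hp, hq, rfl, rfl⟩
      have : P.candidates[P.candidates.idxOf p]? = some p :=
        List.getElem?_idxOf hp.2.2
      simp only [this, hp, if_true]
      exact List.mem_map.2 ⟨q, hq, rfl⟩
  nodup_ports c := by
    split
    · simp
    · split
      · refine nodup_gkNeighbors.map_on fun x hx y _ hxy => (List.idxOf_inj ?_).1 hxy
        exact (mem_gkNeighbors.1 hx).2.1.2.2
      · simp

theorem gk_adj {c d : ℕ} : (P.gk G).graph.Adj c d ↔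
    ∃ p q, P.IsGkVertex G p ∧ q ∈ P.gkNeighbors G p ∧
      c = P.candidates.idxOf p ∧ d = P.candidates.idxOf q := Iff.rfl

theorem getElem?_candidates_idxOf (hp : P.IsGkVertex G p) :
    P.candidates[P.candidates.idxOf p]? = some p :=
  List.getElem?_idxOf hp.2.2

theorem gk_ports (hp : P.IsGkVertex G p) :
    (P.gk G).ports (P.candidates.idxOf p) = (P.gkNeighbors G p).map P.candidates.idxOf := by
  simp only [gk, getElem?_candidates_idxOf hp, hp, if_true]

theorem mem_gk_verts {c : ℕ} :
    c ∈ (P.gk G).verts ↔ ∃ p, P.IsGkVertex G p ∧ c = P.candidates.idxOf p := by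
  simp only [gk, Finset.mem_image, Finset.mem_filter, List.mem_toFinset]
  exact ⟨fun ⟨p, hp, h⟩ => ⟨p, hp.2, h.symm⟩, fun ⟨p, hp, h⟩ => ⟨p, ⟨hp.2.2, hp⟩, h.symm⟩⟩

theorem run_simProbeGk (h : P.Fits G) (hp : P.IsGkVertex G p) (i : ℕ) :
    (P.simProbeGk (P.candidates.idxOf p) i).run (G.wanswer w) =
      (P.gk G).answer (P.candidates.idxOf p) i := by
  simp only [simProbeGk, getElem?_candidates_idxOf hp, Prog.run_bind, run_probeGk h,
    LabeledGraph.answer, gk_ports hp, List.getElem?_map]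
  cases hi : (P.gkNeighbors G p)[i]? with
  | none => rfl
  | some q =>
    have hq := (mem_gkNeighbors.1 (List.mem_of_getElem? hi)).2.1
    simp only [Prog.run_bind, run_probeGk h, Prog.run_pure, Option.map_some, gk_ports hq]
    rw [List.idxOf_map_of_injOn (List.idxOf_injOn P.candidates)
      (fun x hx => (mem_gkNeighbors.1 hx).2.1.2.2) hp.2.2]

/-- Two units of `2k+1`: the neighbor `q` reaches one unit beyond `p`, and the balls around `q`,
explored to find the port back to `p`, one more. -/
theorem near_of_mem_probed_simProbeGk (h : P.Fits G) (hp : P.IsGkVertex G p) {S : Set ℕ}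
    {d i x : ℕ} (hS : ∀ y ∈ p, Near G.graph S d y)
    (hx : x ∈ (P.simProbeGk (P.candidates.idxOf p) i).probed (G.wanswer w)) :
    Near G.graph S (d + 2 * (2 * P.k + 1)) x := by
  simp only [simProbeGk, getElem?_candidates_idxOf hp, Prog.probed_bind, run_probeGk h,
    List.mem_append] at hx
  rcases hx with hx | hx
  · exact (near_of_mem_probed_probeGk h hS hx).mono (by omega)
  · cases hi : (P.gkNeighbors G p)[i]? with
    | none => simp [hi] at hx
    | some q =>
      simp only [hi, Prog.probed_bind, Prog.probed_pure, List.append_nil] at hx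
      obtain ⟨-, hq, v, hv, hvq⟩ := mem_gkNeighbors.1 (List.mem_of_getElem? hi)
      exact (near_of_mem_probed_probeGk h (fun y hy => hq.near hvq hy (hS v hv)) hx).mono
        (by omega)

theorem maxDeg_gk_le (h : P.Fits G) :
    (P.gk G).maxDeg ≤ (2 * P.k + 2) ^ 3 * P.Δ ^ (2 * P.k + 1) := by
  refine Finset.sup_le fun c hc => ?_
  obtain ⟨p, hp, rfl⟩ := mem_gk_verts.1 hc
  rw [gk_ports hp, List.length_map, h.deg]
  refine G.length_le_of_forall_meets hp.length_le nodup_gkNeighbors ?_ fun q hq => ?_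
  · obtain ⟨a, b, hab⟩ := hp.exists_adj
    exact (List.length_pos_of_mem ((G.mem_ports a b).2 hab)).trans_le (G.length_ports_le a)
  · obtain ⟨-, hq, hv⟩ := mem_gkNeighbors.1 hq
    exact ⟨hq.2.1, hq.length_le, hv⟩

theorem near_of_walk_gk {S : Set ℕ} {c e d : ℕ} (W : (P.gk G).graph.Walk c e)
    (hp : P.IsGkVertex G p) (hc : c = P.candidates.idxOf p)
    (hS : ∀ y ∈ p, Near G.graph S d y) :
    ∃ q, P.IsGkVertex G q ∧ e = P.candidates.idxOf q ∧
      ∀ y ∈ q, Near G.graph S (d + (2 * P.k + 1) * W.length) y := by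
  induction W generalizing p d with
  | nil => exact ⟨p, hp, hc, by simpa using hS⟩
  | cons hadj W ih =>
    obtain ⟨p', q, -, hq, hc', rfl⟩ := gk_adj.1 hadj
    obtain rfl : p = p' := (List.idxOf_inj hp.2.2).1 (hc.symm.trans hc')
    obtain ⟨-, hq, v, hv, hvq⟩ := mem_gkNeighbors.1 hq
    obtain ⟨q', hq', he, hS'⟩ := ih hq rfl fun y hy => hq.near hvq hy (hS v hv)
    exact ⟨q', hq', he, fun y hy => (hS' y hy).mono (by
      rw [SimpleGraph.Walk.length_cons, Nat.mul_succ]; omega)⟩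

/-- The bound on the degrees of `G_k` that is passed to the coloring algorithm. -/
def gkDeg (P : OracleInput) : ℕ := (2 * P.k + 2) ^ 3 * P.Δ ^ (2 * P.k + 1)

/-- A bound on the number of colors of the coloring of `G_k`. -/
def gkColors (P : OracleInput) (A : ℕ) : ℕ := A * (P.gkDeg + 1) ^ A

/-- A bound on the probe radius of the coloring algorithm on `G_k`. -/
noncomputable def gkRadius (P : OracleInput) (A : ℕ) : ℕ :=
  A * (logStar (P.candidates.length : ℕ) + (P.gkDeg + 1) ^ A)

/-- A finite distance in `G_k` yields a walk, so a probed ID belongs to the component of `p` and is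
the ID of a genuine path or cycle. Hence the radius bound also guarantees that the simulation
answers all the probes correctly. -/
theorem exists_of_mem_probed_coloring {A : ℕ} (hC : IsColoringAlg A P.C) (h : P.Fits G)
    (hp : P.IsGkVertex G p) {S : Set ℕ} {d c : ℕ} (hS : ∀ y ∈ p, Near G.graph S d y)
    (hc : c ∈ (P.C P.candidates.length P.gkDeg (P.candidates.idxOf p)).probed (P.gk G).answer) :
    ∃ q, P.IsGkVertex G q ∧ c = P.candidates.idxOf q ∧
      ∀ y ∈ q, Near G.graph S (d + (2 * P.k + 1) * P.gkRadius A) y := by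
  have hv : ∀ v ∈ (P.gk G).verts, v < P.candidates.length := fun v hv => by
    obtain ⟨q, hq, rfl⟩ := mem_gk_verts.1 hv
    exact List.idxOf_lt_length_iff.2 hq.2.2
  have hdist := (hC P.candidates.length P.gkDeg (P.gk G) hv (maxDeg_gk_le h)).2.2 _
    (mem_gk_verts.2 ⟨p, hp, rfl⟩) c hc
  obtain ⟨W, hW⟩ := SimpleGraph.exists_walk_of_edist_ne_top
    (ne_top_of_le_ne_top (ENat.natCast_ne_top _) hdist)
  rw [← hW, Nat.cast_le] at hdist
  obtain ⟨q, hq, he, hS'⟩ := near_of_walk_gk W hp rfl hS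
  exact ⟨q, hq, he, fun y hy => (hS' y hy).mono
    (Nat.add_le_add_left (Nat.mul_le_mul_left _ hdist) _)⟩

theorem run_simProbeGk_of_mem_probed {A : ℕ} (hC : IsColoringAlg A P.C) (h : P.Fits G)
    (hp : P.IsGkVertex G p) (c : ℕ)
    (hc : c ∈ (P.C P.candidates.length P.gkDeg (P.candidates.idxOf p)).probed (P.gk G).answer)
    (i : ℕ) : (P.simProbeGk c i).run (G.wanswer w) = (P.gk G).answer c i := by
  obtain ⟨q, hq, rfl, -⟩ := exists_of_mem_probed_coloring hC h hp
    (S := {y | y ∈ p}) (d := 0) (fun y hy => Near.of_mem hy) hc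
  exact run_simProbeGk h hq i

theorem run_color_lt {A : ℕ} (hC : IsColoringAlg A P.C) (h : P.Fits G)
    (hp : P.IsGkVertex G p) : (P.color p).run (G.wanswer w) < P.gkColors A := by
  have hv : ∀ v ∈ (P.gk G).verts, v < P.candidates.length := fun v hv => by
    obtain ⟨q, hq, rfl⟩ := mem_gk_verts.1 hv
    exact List.idxOf_lt_length_iff.2 hq.2.2
  have := (hC P.candidates.length P.gkDeg (P.gk G) hv (maxDeg_gk_le h)).2.1 _
    (mem_gk_verts.2 ⟨p, hp, rfl⟩)
  rwa [← Prog.run_simulate (ans' := G.wanswer w) _ (run_simProbeGk_of_mem_probed hC h hp)] at this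

theorem near_of_mem_probed_color {A : ℕ} (hC : IsColoringAlg A P.C) (h : P.Fits G)
    (hp : P.IsGkVertex G p) {S : Set ℕ} {d x : ℕ} (hS : ∀ y ∈ p, Near G.graph S d y)
    (hx : x ∈ (P.color p).probed (G.wanswer w)) :
    Near G.graph S (d + (2 * P.k + 1) * (P.gkRadius A + 2)) x := by
  obtain ⟨c, hc, i, hx⟩ := Prog.exists_of_mem_probed_simulate _
    (run_simProbeGk_of_mem_probed hC h hp) hx
  obtain ⟨q, hq, rfl, hS'⟩ := exists_of_mem_probed_coloring hC h hp hS hc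
  exact (near_of_mem_probed_simProbeGk h hq hS' hx).mono (by rw [mul_add _ (P.gkRadius A) 2]; omega)

end OracleInput

/-! ### Growth of the probe radius in one step -/

namespace OracleInput

variable {P : OracleInput} {G : LabeledGraph} {w : Sym2 ℕ → ℝ} {p q : List ℕ}
  {O : ℕ → ℕ → WProg Bool} {g : ℝ} {r A : ℕ}

theorem near_of_probeRadiusLE (hO : ProbeRadiusLE G w O r) {S : Set ℕ} {d u v x : ℕ}
    (hu : Near G.graph S d u) (hv : Near G.graph S d v) (huv : G.graph.Adj u v)
    (hx : x ∈ (O u v).probed (G.wanswer w)) : Near G.graph S (d + r) x := by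
  rcases hO u v huv x hx with h | h
  all_goals
    obtain ⟨W, hW⟩ := SimpleGraph.exists_walk_of_edist_ne_top
      (ne_top_of_le_ne_top (ENat.natCast_ne_top _) h)
    rw [← hW, Nat.cast_le] at h
  · exact (hu.append W).mono (by omega)
  · exact (hv.append W).mono (by omega)

theorem near_of_mem_probed_matchedEdges (h : P.Fits G) (hO : ProbeRadiusLE G w O r)
    {S : Set ℕ} {T : List ℕ} {d d' x : ℕ} (hT : ∀ t ∈ T, Near G.graph S d t)
    (hx : x ∈ (matchedEdges O ((P.ballEdges d' T).run (G.wanswer w))).probed (G.wanswer w)) :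
    Near G.graph S (d + d' + r) x := by
  obtain ⟨t, ht, hx⟩ := exists_of_mem_probed_matchedEdges hx
  obtain ⟨h1, h2, -, hadj, -⟩ := (mem_run_ballEdges h _ _ _).1 ht
  exact near_of_probeRadiusLE hO (Near.trans hT h1) (Near.trans hT h2) hadj hx

theorem near_of_mem_probed_probeH (h : P.Fits G) (hO : ProbeRadiusLE G w O r) {S : Set ℕ}
    {d x : ℕ} (hS : ∀ y ∈ p, Near G.graph S d y)
    (hx : x ∈ (P.probeH O g p).probed (G.wanswer w)) :
    Near G.graph S (d + (2 * P.k + 1) + r) x := by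
  simp only [probeH, Prog.probed_bind, List.mem_append, Prog.mem_probed_collect,
    Prog.probed_pure, List.not_mem_nil, or_false] at hx
  obtain ⟨v, hv, hx⟩ := hx
  have hv' : ∀ t ∈ [v], Near G.graph S d t := by simpa using hS v hv
  rcases hx with hx | hx
  · exact (Near.trans hv' (near_of_mem_probed_ballEdges h _ _ hx)).mono (by omega)
  · exact near_of_mem_probed_matchedEdges h hO hv' hx

/-- Only the intersection with `p` is retained: for the radius it is irrelevant which paths are
augmenting, or what `O` answers. -/
theorem mem_run_probeH (h : P.Fits G) (hq : q ∈ (P.probeH O g p).run (G.wanswer w)) :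
    P.IsGkVertex G q ∧ ∃ v ∈ p, v ∈ q := by
  simp only [probeH, Prog.run_bind, Prog.run_collect, Prog.run_pure, List.mem_filter,
    decide_eq_true_eq, List.mem_flatten, List.mem_map] at hq
  obtain ⟨hq, -, _, ⟨v, hv, rfl⟩, hm⟩ := hq
  simp only [List.mem_filter, decide_eq_true_eq] at hm
  exact ⟨isGkVertex_of_isPathOrCycle h hq hm.2.1.1, v, hv, hm.2.2⟩

/-- Each level of the recursion moves the center by at most `2k+1`. The radius `r` of `O` enters
only once, because `O` is called at the current center and its probes do not shift later ones. -/
theorem near_of_mem_probed_misDFS (hC : IsColoringAlg A P.C) (h : P.Fits G)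
    (hO : ProbeRadiusLE G w O r) {S : Set ℕ} {c d x : ℕ}
    (hp : P.IsGkVertex G p) (hS : ∀ y ∈ p, Near G.graph S d y)
    (hx : x ∈ (P.misDFS O g c p).probed (G.wanswer w)) :
    Near G.graph S (d + (2 * P.k + 1) * (c + (P.gkRadius A + 2)) + r) x := by
  induction c generalizing p d with
  | zero => simp [misDFS] at hx
  | succ c ih =>
    have hmul : (2 * P.k + 1) * (c + 1 + (P.gkRadius A + 2)) =
        (2 * P.k + 1) + (2 * P.k + 1) * c + (2 * P.k + 1) * (P.gkRadius A + 2) := by ring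
    simp only [misDFS, Prog.probed_bind, List.mem_append, Prog.probed_pure, List.not_mem_nil,
      or_false] at hx
    rcases hx with hx | hx | hx
    · exact (near_of_mem_probed_color hC h hp hS hx).mono (by omega)
    · exact (near_of_mem_probed_probeH h hO hS hx).mono (by omega)
    · obtain ⟨q, hq, hx⟩ := Prog.exists_of_mem_probed_anyTrue hx
      obtain ⟨hG, v, hv, hvq⟩ := mem_run_probeH h hq
      have hSq : ∀ y ∈ q, Near G.graph S (d + (2 * P.k + 1)) y :=
        fun y hy => hG.near hvq hy (hS v hv)
      simp only [Prog.probed_bind, List.mem_append] at hx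
      rcases hx with hx | hx
      · exact (near_of_mem_probed_color hC h hG hSq hx).mono (by omega)
      · split at hx
        · exact (ih hG hSq hx).mono (by rw [hmul, mul_add _ c]; omega)
        · simp at hx

/-- A bound on the number by which the probe radius grows in each step. -/
noncomputable def stepRadius (P : OracleInput) (A : ℕ) : ℕ :=
  (2 * P.k + 1) * (P.gkColors A + P.gkRadius A + 3)

/-- The depth of the DFS is the color of `p`, which is below `gkColors`. -/
theorem near_of_mem_probed_lmis (hC : IsColoringAlg A P.C) (h : P.Fits G)
    (hO : ProbeRadiusLE G w O r) {S : Set ℕ} {d x : ℕ}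
    (hp : P.IsGkVertex G p) (hS : ∀ y ∈ p, Near G.graph S d y)
    (hx : x ∈ (P.lmis O g p).probed (G.wanswer w)) :
    Near G.graph S (d + (2 * P.k + 1) * (P.gkColors A + (P.gkRadius A + 2)) + r) x := by
  simp only [lmis, Prog.probed_bind, List.mem_append] at hx
  have := run_color_lt (w := w) hC h hp
  rcases hx with hx | hx
  · refine (near_of_mem_probed_color hC h hp hS hx).mono ?_
    have := Nat.mul_le_mul_left (2 * P.k + 1)
      (Nat.le_add_left (P.gkRadius A + 2) (P.gkColors A))
    omega
  · refine (near_of_mem_probed_misDFS hC h hO hp hS hx).mono ?_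
    gcongr

theorem near_of_mem_probed_procA (hC : IsColoringAlg A P.C) (h : P.Fits G)
    (hO : ProbeRadiusLE G w O r) {u v x : ℕ}
    (hx : x ∈ (P.procA O g u v).probed (G.wanswer w)) :
    Near G.graph {y | y ∈ [u, v]} (r + P.stepRadius A) x := by
  have hmul : P.stepRadius A = (2 * P.k + 1) +
      (2 * P.k + 1) * (P.gkColors A + (P.gkRadius A + 2)) := by rw [stepRadius]; ring
  have hT : ∀ t ∈ [u, v], Near G.graph {y | y ∈ [u, v]} 0 t := fun t ht => Near.of_mem ht
  simp only [procA, Prog.probed_bind, List.mem_append] at hx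
  rcases hx with hx | hx | hx
  · exact (near_of_mem_probed_ballEdges h _ _ hx).mono (by omega)
  · exact (near_of_mem_probed_matchedEdges h hO hT hx).mono (by omega)
  · obtain ⟨p, hp, hx⟩ := Prog.exists_of_mem_probed_anyTrue hx
    simp only [List.mem_filter, decide_eq_true_eq] at hp
    have hG := isGkVertex_of_isPathOrCycle h hp.1 hp.2.1.1
    -- The path contains `u`, so all its vertices are within `2k+1` of the query; this is the last
    -- of the three extra units in `stepRadius`.
    exact (near_of_mem_probed_lmis hC h hO hG
      (fun y hy => hG.near (left_mem_of_mem_edgesOf hp.2.2) hy (hT u (by simp))) hx).mono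
      (by omega)

theorem probeRadiusLE_step (hC : IsColoringAlg A P.C) (h : P.Fits G)
    (hO : ProbeRadiusLE G w O r) : ProbeRadiusLE G w (P.step O g) (r + P.stepRadius A) := by
  intro u v huv x hx
  simp only [step, Prog.probed_bind, List.mem_append, Prog.probed_pure, List.not_mem_nil,
    or_false] at hx
  rcases hx with hx | hx
  · exact (hO u v huv x hx).imp (fun h => h.trans (by norm_cast; omega))
      fun h => h.trans (by norm_cast; omega)
  · obtain ⟨s, hs, W, hW⟩ := near_of_mem_probed_procA hC h hO hx
    have hW' : (W.length : ℕ∞) ≤ (r + P.stepRadius A : ℕ) := by exact_mod_cast hW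
    rcases List.mem_pair.1 hs with rfl | rfl
    · exact .inl (W.edist_le.trans hW')
    · exact .inr (W.edist_le.trans hW')

theorem probeRadiusLE_sweep (hC : IsColoringAlg A P.C) (h : P.Fits G) (gains : List ℝ)
    (hO : ProbeRadiusLE G w O r) :
    ProbeRadiusLE G w (P.sweep gains O) (r + gains.length * P.stepRadius A) := by
  induction gains generalizing O r with
  | nil => simpa [sweep] using hO
  | cons g gains ih =>
    have := ih (probeRadiusLE_step (g := g) hC h hO)
    rw [List.length_cons, add_mul, one_mul, add_comm (gains.length * _), ← add_assoc]
    exact this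

/-- The probe radius of the oracle after `L` sweeps. -/
theorem probeRadiusLE_oracle (hC : IsColoringAlg A P.C) (h : P.Fits G) (gains : List ℝ) {L : ℕ}
    (hL : 1 ≤ L) :
    ProbeRadiusLE G w (P.oracle gains L gains.length)
      (L * gains.length * P.stepRadius A) := by
  have key : ∀ m : ℕ, ProbeRadiusLE G w ((P.sweep gains)^[m] fun _ _ => pure false)
      (m * gains.length * P.stepRadius A) := by
    intro m
    induction m with
    | zero => intro u v _ x hx; simp at hx
    | succ m ih =>
      rw [Function.iterate_succ_apply', add_mul, add_mul, one_mul]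
      exact probeRadiusLE_sweep hC h gains ih
  have := key L
  -- The oracle makes `L - 1` full sweeps and then processes the whole list once more, that is, `L`
  -- sweeps.
  obtain ⟨m, rfl⟩ : ∃ m, L = m + 1 := ⟨L - 1, by omega⟩
  rw [Function.iterate_succ_apply'] at this
  simpa [oracle] using this

end OracleInput

/-! ### The iterated logarithm and powers of two -/

/-- The tower of `t` twos. -/
def tower : ℕ → ℕ
  | 0 => 1
  | t + 1 => 2 ^ tower t

theorem one_le_tower (t : ℕ) : 1 ≤ tower t := by
  cases t with
  | zero => exact le_rfl
  | succ t => exact Nat.one_le_two_pow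

theorem lt_tower (t : ℕ) : t < tower t := by
  induction t with
  | zero => exact Nat.one_pos
  | succ t ih => exact (Nat.succ_le_of_lt ih).trans_lt Nat.lt_two_pow_self

/-- One further level of the tower at least doubles it, which pays for one more summand `tower t`.
-/
theorem mul_tower_le (c t : ℕ) : c * tower t ≤ tower (t + c) := by
  induction c with
  | zero => simp
  | succ c ih =>
    have h1 : tower t ≤ tower (t + c) := by
      rcases Nat.eq_zero_or_pos c with rfl | hc
      · exact le_rfl
      · exact (Nat.le_mul_of_pos_left _ hc).trans ih
    have h2 : tower (t + c) * 2 ≤ 2 ^ tower (t + c) := by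
      obtain ⟨m, hm⟩ := Nat.exists_eq_add_of_le' (one_le_tower (t + c))
      rw [hm, pow_succ]
      exact Nat.mul_le_mul_right 2 Nat.lt_two_pow_self
    calc (c + 1) * tower t = c * tower t + tower t := by ring
      _ ≤ tower (t + c) * 2 := by omega
      _ ≤ tower (t + (c + 1)) := h2

/-- A power is a multiplication of the exponent, one level lower in the tower. -/
theorem tower_pow_le (c t : ℕ) : tower t ^ c ≤ tower (t + c) := by
  cases t with
  | zero => simpa [tower] using one_le_tower _
  | succ t =>
    rw [tower, ← pow_mul, mul_comm, add_right_comm]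
    exact Nat.pow_le_pow_right (by norm_num) (mul_tower_le c t)

theorem le_tower_of_iterate_logb_le {i : ℕ} {x : ℝ} (h : (Real.logb 2)^[i] x ≤ 1) :
    x ≤ tower i := by
  induction i generalizing x with
  | zero => simpa [tower] using h
  | succ i ih =>
    rcases le_or_gt x 0 with hx | hx
    · exact hx.trans (Nat.cast_nonneg _)
    · rw [Function.iterate_succ_apply] at h
      have := (Real.logb_le_iff_le_rpow one_lt_two hx).1 (ih h)
      simpa [tower] using this

/-- The iteration must be allowed to stop early: once the value is nonpositive, `Real.logb`
continues with absolute values and may exceed `1` again. -/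
theorem exists_iterate_logb_le {i : ℕ} {x : ℝ} (h : x ≤ tower i) :
    ∃ j ≤ i, (Real.logb 2)^[j] x ≤ 1 := by
  induction i generalizing x with
  | zero => exact ⟨0, le_rfl, by simpa [tower] using h⟩
  | succ i ih =>
    rcases le_or_gt x 1 with hx | hx
    · exact ⟨0, by omega, by simpa using hx⟩
    · obtain ⟨j, hj, h⟩ := ih (x := Real.logb 2 x)
        ((Real.logb_le_iff_le_rpow one_lt_two (by linarith)).2 (by simpa [tower] using h))
      exact ⟨j + 1, by omega, h⟩

theorem logStar_le {i : ℕ} {x : ℝ} (h : x ≤ tower i) : logStar x ≤ i := by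
  obtain ⟨j, hj, h⟩ := exists_iterate_logb_le h
  exact (Nat.sInf_le h).trans hj

theorem le_tower_logStar (n : ℕ) : n ≤ tower (logStar n) := by
  obtain ⟨j, -, h⟩ := exists_iterate_logb_le (i := n) (x := n)
    (by exact_mod_cast (lt_tower n).le)
  have := le_tower_of_iterate_logb_le
    (Nat.sInf_mem (s := {i : ℕ | (Real.logb 2)^[i] n ≤ 1}) ⟨j, h⟩)
  exact_mod_cast this

theorem logStar_le_of_le_pow {m n c : ℕ} (h : m ≤ n ^ c) : logStar m ≤ logStar n + c := by
  refine logStar_le ?_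
  exact_mod_cast (h.trans (Nat.pow_le_pow_left (le_tower_logStar n) c)).trans (tower_pow_le c _)

/-! ### Linial's color reduction -/

open Polynomial in
/-- The polynomial over `ℤ/q` whose coefficients are the lowest `d` bits of `c`. -/
noncomputable def bitPoly (q d c : ℕ) : (ZMod q)[X] :=
  ∑ i ∈ Finset.range d, C (if c.testBit i then 1 else 0) * X ^ i

theorem coeff_bitPoly {q d c i : ℕ} (hi : i < d) :
    (bitPoly q d c).coeff i = if c.testBit i then 1 else 0 := by
  simp only [bitPoly, Polynomial.finsetSum_coeff, Polynomial.coeff_C_mul_X_pow,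
    Finset.sum_ite_eq, Finset.mem_range, hi, if_true]

theorem degree_bitPoly_lt (q d c : ℕ) : (bitPoly q d c).degree < d := by
  refine (Polynomial.degree_sum_le _ _).trans_lt ?_
  refine (Finset.sup_lt_iff (WithBot.bot_lt_coe d)).2 fun i hi => ?_
  exact (Polynomial.degree_C_mul_X_pow_le i _).trans_lt
    (WithBot.coe_lt_coe.2 (Finset.mem_range.1 hi))

theorem bitPoly_injOn {q d : ℕ} [Fact q.Prime] {c c' : ℕ} (hc : c < 2 ^ d) (hc' : c' < 2 ^ d)
    (h : bitPoly q d c = bitPoly q d c') : c = c' := by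
  refine Nat.eq_of_testBit_eq fun i => ?_
  rcases lt_or_ge i d with hi | hi
  · have := congrArg (fun p => p.coeff i) h
    simp only [coeff_bitPoly hi] at this
    by_cases h1 : c.testBit i <;> by_cases h2 : c'.testBit i <;> simp_all
  · rw [Nat.testBit_lt_two_pow (hc.trans_le (Nat.pow_le_pow_right two_pos hi)),
      Nat.testBit_lt_two_pow (hc'.trans_le (Nat.pow_le_pow_right two_pos hi))]

/-- The value of the polynomial of the color `c` at `x`. -/
noncomputable def bitEval (q d c x : ℕ) : ℕ := ((bitPoly q d c).eval (x : ZMod q)).val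

/-- Distinct polynomials of degree below `d` over a field cannot agree at more than `d` points. -/
theorem card_agree_le {q d : ℕ} [Fact q.Prime] {c c' : ℕ} (hc : c < 2 ^ d) (hc' : c' < 2 ^ d)
    (hne : c ≠ c') :
    ((Finset.range q).filter fun x => bitEval q d c x = bitEval q d c' x).card ≤ d := by
  by_contra! hlt
  refine hne (bitPoly_injOn (q := q) hc hc' ?_)
  set s := (Finset.range q).filter fun x => bitEval q d c x = bitEval q d c' x
  have hinj : Set.InjOn (fun x : ℕ => (x : ZMod q)) s := by
    intro x hx y hy hxy
    have hx := Finset.mem_range.1 (Finset.mem_filter.1 (Finset.mem_coe.1 hx)).1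
    have hy := Finset.mem_range.1 (Finset.mem_filter.1 (Finset.mem_coe.1 hy)).1
    have := (ZMod.natCast_eq_natCast_iff' _ _ _).1 hxy
    rwa [Nat.mod_eq_of_lt hx, Nat.mod_eq_of_lt hy] at this
  refine Polynomial.eq_of_degrees_lt_of_eval_index_eq s hinj
    ((degree_bitPoly_lt _ _ _).trans (by exact_mod_cast hlt))
    ((degree_bitPoly_lt _ _ _).trans (by exact_mod_cast hlt)) fun x hx => ?_
  exact ZMod.val_injective q (Finset.mem_filter.1 hx).2

/-- A point at which the polynomial of `c` differs from those of all the colors in `cs`. -/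
noncomputable def separatingPoint (q d c : ℕ) (cs : List ℕ) : ℕ :=
  ((List.range q).find? fun x => ∀ c' ∈ cs, bitEval q d c x ≠ bitEval q d c' x).getD 0

/-- Each of the at most `D` neighbor colors spoils at most `d` of the `q` points, and `D * d < q`.
-/
theorem separatingPoint_spec {q d D : ℕ} [Fact q.Prime] (hq : D * d < q) {c : ℕ} {cs : List ℕ}
    (hc : c < 2 ^ d) (hcs : ∀ c' ∈ cs, c' < 2 ^ d ∧ c ≠ c') (hlen : cs.length ≤ D) :
    separatingPoint q d c cs < q ∧ ∀ c' ∈ cs,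
      bitEval q d c (separatingPoint q d c cs) ≠ bitEval q d c' (separatingPoint q d c cs) := by
  have hex : ∃ x ∈ List.range q, ∀ c' ∈ cs, bitEval q d c x ≠ bitEval q d c' x := by
    by_contra! hcon
    have hsub : Finset.range q ⊆ cs.toFinset.biUnion fun c' =>
        (Finset.range q).filter fun x => bitEval q d c x = bitEval q d c' x := by
      intro x hx
      obtain ⟨c', hc', h⟩ := hcon x (List.mem_range.2 (Finset.mem_range.1 hx))
      exact Finset.mem_biUnion.2 ⟨c', List.mem_toFinset.2 hc', Finset.mem_filter.2 ⟨hx, h⟩⟩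
    have h1 := (Finset.card_le_card hsub).trans (Finset.card_biUnion_le_card_mul _ _ d
      fun c' hc' => card_agree_le hc (hcs c' (List.mem_toFinset.1 hc')).1
        (hcs c' (List.mem_toFinset.1 hc')).2)
    rw [Finset.card_range] at h1
    have h2 : cs.toFinset.card * d ≤ D * d :=
      Nat.mul_le_mul_right _ ((List.toFinset_card_le cs).trans hlen)
    omega
  obtain ⟨y, hy⟩ := Option.isSome_iff_exists.1 ((List.find?_isSome (xs := List.range q)
    (p := fun x => ∀ c' ∈ cs, bitEval q d c x ≠ bitEval q d c' x)).2 (by simpa using hex))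
  have hpt : separatingPoint q d c cs = y := by rw [separatingPoint, hy]; rfl
  rw [hpt]
  exact ⟨List.mem_range.1 (List.mem_of_find?_eq_some hy),
    by simpa using List.find?_some hy⟩

/-- The new color of a vertex of color `c` whose neighbors have the colors `cs`. -/
noncomputable def reducedColor (q d c : ℕ) (cs : List ℕ) : ℕ :=
  separatingPoint q d c cs * q + bitEval q d c (separatingPoint q d c cs)

theorem bitEval_lt (q d c x : ℕ) [Fact q.Prime] : bitEval q d c x < q := ZMod.val_lt _

theorem reducedColor_lt {q d D : ℕ} [Fact q.Prime] (hq : D * d < q) {c : ℕ} {cs : List ℕ}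
    (hc : c < 2 ^ d) (hcs : ∀ c' ∈ cs, c' < 2 ^ d ∧ c ≠ c') (hlen : cs.length ≤ D) :
    reducedColor q d c cs < q ^ 2 := by
  have h1 := (separatingPoint_spec hq hc hcs hlen).1
  have h2 := bitEval_lt q d c (separatingPoint q d c cs)
  rw [reducedColor]
  nlinarith

/-- A color encodes a pair (point, value) in base `q`. Equal pairs have the same point, and there
the values differ by the choice made for `c` alone; hence nothing is needed about `cs'`. -/
theorem reducedColor_ne {q d D : ℕ} [Fact q.Prime] (hq : D * d < q) {c c' : ℕ}
    {cs cs' : List ℕ} (hc : c < 2 ^ d) (hcs : ∀ c' ∈ cs, c' < 2 ^ d ∧ c ≠ c')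
    (hlen : cs.length ≤ D) (hmem : c' ∈ cs) :
    reducedColor q d c cs ≠ reducedColor q d c' cs' := by
  intro h
  have h0 := (separatingPoint_spec hq hc hcs hlen).2 c' hmem
  have h1 := bitEval_lt q d c (separatingPoint q d c cs)
  have h2 := bitEval_lt q d c' (separatingPoint q d c' cs')
  have hq0 : 0 < q := (Fact.out : q.Prime).pos
  rw [reducedColor, reducedColor] at h
  have hdiv := congrArg (· / q) h
  simp only [mul_comm _ q, Nat.mul_add_div hq0, Nat.div_eq_of_lt h1,
    Nat.div_eq_of_lt h2, add_zero] at hdiv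
  rw [← hdiv] at h
  exact h0 (Nat.add_left_cancel h)

theorem exists_prime_gt (n : ℕ) : ∃ q, q.Prime ∧ n < q ∧ q ≤ 2 * (n + 1) := by
  obtain ⟨q, h1, h2, h3⟩ := Nat.exists_prime_lt_and_le_two_mul (n + 1) (by omega)
  exact ⟨q, h1, by omega, h3⟩

/-- The prime that is used to reduce the number of colors when the colors are smaller than `m`. -/
noncomputable def reductionPrime (D m : ℕ) : ℕ := (exists_prime_gt (D * m.size)).choose

theorem reductionPrime_spec (D m : ℕ) : (reductionPrime D m).Prime ∧
    D * m.size < reductionPrime D m ∧ reductionPrime D m ≤ 2 * (D * m.size + 1) :=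
  (exists_prime_gt (D * m.size)).choose_spec

/-- A bound on the colors after `t` rounds of color reduction. -/
noncomputable def colorBound (D N : ℕ) : ℕ → ℕ
  | 0 => N
  | t + 1 => reductionPrime D (colorBound D N t) ^ 2

/-- One round takes the number of colors to the square of `O(D)` times its logarithm. The factor `32
* (D + 1)` in the exponent leaves room for the bound to reproduce itself one tower level lower. -/
theorem colorBound_succ_le {D N t X : ℕ} (hX : 1 ≤ X)
    (h : colorBound D N t ≤ 2 ^ (32 * (D + 1) * X)) :
    colorBound D N (t + 1) ≤ 2 ^ 14 * (D + 1) ^ 4 * X ^ 2 := by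
  have hsize : (colorBound D N t).size ≤ 32 * (D + 1) * X + 1 :=
    Nat.size_le.2 (h.trans_lt (Nat.pow_lt_pow_right (by norm_num) (by omega)))
  have hq := (reductionPrime_spec D (colorBound D N t)).2.2
  have h1 : reductionPrime D (colorBound D N t) ≤ 2 ^ 7 * (D + 1) ^ 2 * X := by
    have := Nat.mul_le_mul_left D hsize
    have hD : D * 1 ≤ D * X := Nat.mul_le_mul_left D hX
    nlinarith [Nat.zero_le (D * D * X)]
  calc colorBound D N (t + 1) ≤ (2 ^ 7 * (D + 1) ^ 2 * X) ^ 2 := Nat.pow_le_pow_left h1 2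
    _ = _ := by ring

theorem colorBound_le_of_tower {D N T : ℕ} (hN : N ≤ tower T) (t : ℕ) (ht : t ≤ T) :
    colorBound D N t ≤ 2 ^ (32 * (D + 1) * tower (T - t)) := by
  induction t with
  | zero =>
    have h1 : tower T ≤ 32 * (D + 1) * tower T := Nat.le_mul_of_pos_left _ (by omega)
    exact hN.trans (Nat.lt_two_pow_self.le.trans (Nat.pow_le_pow_right (by norm_num) h1))
  | succ t ih =>
    obtain ⟨s, hs⟩ : ∃ s, T - t = s + 1 := ⟨T - t - 1, by omega⟩
    have hs' : T - (t + 1) = s := by omega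
    have := colorBound_succ_le (one_le_tower _) (ih (by omega))
    rw [hs] at this
    rw [hs']
    refine this.trans ?_
    have hD : (D + 1) ^ 4 ≤ 2 ^ (D * 4) := by
      rw [pow_mul]
      exact Nat.pow_le_pow_left Nat.lt_two_pow_self 4
    have h1 := one_le_tower s
    calc 2 ^ 14 * (D + 1) ^ 4 * tower (s + 1) ^ 2
        ≤ 2 ^ 14 * 2 ^ (D * 4) * tower (s + 1) ^ 2 := by gcongr
      _ = 2 ^ (14 + D * 4 + tower s * 2) := by rw [tower]; ring
      _ ≤ 2 ^ (32 * (D + 1) * tower s) := by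
        refine Nat.pow_le_pow_right (by norm_num) ?_
        have hD : D * 1 ≤ D * tower s := Nat.mul_le_mul_left D h1
        nlinarith

theorem colorBound_logStar_le (D N : ℕ) :
    colorBound D N (logStar N + 1) ≤ 2 ^ 14 * (D + 1) ^ 4 := by
  -- After `log* N` rounds the tower has shrunk to `1`; one more round removes the remaining
  -- exponential dependence on `D`.
  have := colorBound_succ_le le_rfl (by
    simpa [tower] using colorBound_le_of_tower (D := D) (le_tower_logStar N) _ le_rfl)
  simpa using this

/-- The color of `v` after `t` rounds of color reduction. -/
noncomputable def reducedColoring (D N : ℕ) : ℕ → ℕ → Prog (ℕ × ℕ) ℕ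
  | 0, v => pure v
  | t + 1, v => do
      let nb ← Prog.collect (fun i => Prog.probe v i Prog.ret) (List.range D)
      let cs ← Prog.collect (reducedColoring D N t) (nb.filterMap fun o => o.map Prod.fst)
      let c ← reducedColoring D N t v
      pure (reducedColor (reductionPrime D (colorBound D N t)) (colorBound D N t).size c cs)

section

variable {D N : ℕ} {Γ : LabeledGraph}

theorem filterMap_answer (hD : Γ.maxDeg ≤ D) (v : ℕ) :
    ((List.range D).map fun i => Γ.answer v i).filterMap (fun o => o.map Prod.fst) =
      Γ.ports v := by
  have := Γ.filterMap_range_ports id v hD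
  rw [List.map_id] at this
  rw [← this]
  simp [LabeledGraph.answer, List.filterMap_map, Function.comp_def]

theorem run_reducedColoring_succ (hD : Γ.maxDeg ≤ D) (t v : ℕ) :
    (reducedColoring D N (t + 1) v).run Γ.answer =
      reducedColor (reductionPrime D (colorBound D N t)) (colorBound D N t).size
        ((reducedColoring D N t v).run Γ.answer)
        ((Γ.ports v).map fun u => (reducedColoring D N t u).run Γ.answer) := by
  simp only [reducedColoring, Prog.run_bind, Prog.run_collect, Prog.run_probe, Prog.run_ret,
    Prog.run_pure, filterMap_answer hD]

theorem run_reducedColoring (hN : ∀ v ∈ Γ.verts, v < N) (hD : Γ.maxDeg ≤ D) (t : ℕ) :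
    (∀ v ∈ Γ.verts, (reducedColoring D N t v).run Γ.answer < colorBound D N t) ∧
    ∀ u v, Γ.graph.Adj u v →
      (reducedColoring D N t u).run Γ.answer ≠ (reducedColoring D N t v).run Γ.answer := by
  induction t with
  | zero => exact ⟨hN, fun u v h => h.ne⟩
  | succ t ih =>
    obtain ⟨hq, hlt, -⟩ := reductionPrime_spec D (colorBound D N t)
    have := Fact.mk hq
    have hb : ∀ v ∈ Γ.verts,
        (reducedColoring D N t v).run Γ.answer < 2 ^ (colorBound D N t).size :=
      fun v hv => (ih.1 v hv).trans (Nat.lt_size_self _)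
    have hcs : ∀ v, ∀ c' ∈ (Γ.ports v).map fun u => (reducedColoring D N t u).run Γ.answer,
        c' < 2 ^ (colorBound D N t).size ∧ (reducedColoring D N t v).run Γ.answer ≠ c' := by
      intro v c' hc'
      obtain ⟨u, hu, rfl⟩ := List.mem_map.1 hc'
      have hadj := (Γ.mem_ports _ _).1 hu
      exact ⟨hb u (Γ.mem_verts _ _ hadj.symm), ih.2 _ _ hadj⟩
    have hlen : ∀ v, ((Γ.ports v).map fun u =>
        (reducedColoring D N t u).run Γ.answer).length ≤ D := fun v => by
      rw [List.length_map]
      exact (Γ.length_ports_le v).trans hD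
    refine ⟨fun v hv => ?_, fun u v hadj => ?_⟩
    · rw [run_reducedColoring_succ hD]
      exact reducedColor_lt hlt (hb v hv) (hcs v) (hlen v)
    · rw [run_reducedColoring_succ hD, run_reducedColoring_succ hD]
      exact reducedColor_ne hlt (hb u (Γ.mem_verts _ _ hadj)) (hcs u) (hlen u)
        (List.mem_map.2 ⟨v, (Γ.mem_ports _ _).2 hadj, rfl⟩)

theorem near_of_mem_probed_reducedColoring (hD : Γ.maxDeg ≤ D) {t v x : ℕ}
    (hx : x ∈ (reducedColoring D N t v).probed Γ.answer) : Near Γ.graph {v} t x := by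
  induction t generalizing v with
  | zero => simp [reducedColoring] at hx
  | succ t ih =>
    simp only [reducedColoring, Prog.probed_bind, Prog.run_collect, Prog.run_probe,
      Prog.run_ret, filterMap_answer hD, List.mem_append, Prog.mem_probed_collect,
      Prog.probed_pure, List.not_mem_nil, or_false, Prog.probed_probe, Prog.probed_ret,
      List.mem_singleton] at hx
    rcases hx with ⟨_, -, rfl⟩ | ⟨u, hu, hx⟩ | hx
    · exact Near.of_mem rfl
    · rw [add_comm]
      refine Near.trans (T := {u}) ?_ (ih hx)
      rintro _ rfl
      simpa using (Near.of_mem (d := 0) (Set.mem_singleton v)).adj ((Γ.mem_ports _ _).1 hu)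
    · exact (ih hx).mono (by omega)

end

theorem exists_isColoringAlg : ∃ (A : ℕ) (C : ColoringAlg), IsColoringAlg A C := by
  -- The constant `2 ^ 14` of the color bound also serves, generously, as the degree of the
  -- polynomial.
  refine ⟨2 ^ 14, fun N D v => reducedColoring D N (logStar N + 1) v, fun N D Γ hN hD => ?_⟩
  have hpow : (D + 1) ^ 4 ≤ (D + 1) ^ 2 ^ 14 := Nat.pow_le_pow_right (by omega) (by norm_num)
  obtain ⟨h1, h2⟩ := run_reducedColoring hN hD (logStar N + 1)
  refine ⟨h2, fun v hv => (h1 v hv).trans_le ((colorBound_logStar_le D N).trans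
    (Nat.mul_le_mul_left _ hpow)), fun v _ x hx => ?_⟩
  obtain ⟨_, rfl, W, hW⟩ := near_of_mem_probed_reducedColoring hD hx
  refine W.edist_le.trans ?_
  have : 1 ≤ (D + 1) ^ 2 ^ 14 := Nat.one_le_pow _ _ (by omega)
  exact_mod_cast hW.trans ((by omega : _ ≤ logStar N + (D + 1) ^ 2 ^ 14).trans
    (Nat.le_mul_of_pos_left _ (by norm_num)))

/-! ### The number of possible gains -/

theorem Finset.card_sym_le {α : Type*} [DecidableEq α] (s : Finset α) (m : ℕ) :
    (s.sym m).card ≤ Nat.multichoose s.card m := by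
  have hsub : s.sym m ⊆ (Finset.univ : Finset (Sym s m)).image (Sym.map Subtype.val) := by
    intro t ht
    rw [Finset.mem_sym_iff] at ht
    refine Finset.mem_image.2 ⟨t.attach.map fun x => ⟨x.1, ht x.1 x.2⟩, Finset.mem_univ _, ?_⟩
    rw [Sym.map_map]
    exact Sym.attach_map_coe t
  refine (Finset.card_le_card hsub).trans (Finset.card_image_le.trans ?_)
  rw [Finset.card_univ, Sym.card_sym_eq_multichoose, Fintype.card_coe]

/-- From `-log β ≥ 1 - β ≥ ε / 3` and `-log x ≤ ℓ`, the largest exponent is at most `3ℓ / ε`; the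
summand `1` counts the exponent `0`. -/
theorem card_weightValues_le {ε β x ℓ : ℝ} (hε : 0 < ε) (hε1 : ε < 1)
    (hβ : β = 1 - ε / 2 ∨ β = 1 - ε / 3) (hℓ : 2 ≤ ℓ) (hx : Real.logb 2 (1 / x) ≤ ℓ) :
    ((weightValues β x).card : ℝ) ≤ ⌈3 / ε⌉₊ * ℓ + 1 := by
  have hk : 3 / ε ≤ (⌈3 / ε⌉₊ : ℝ) := Nat.le_ceil _
  have hβ0 : 0 < β := by rcases hβ with rfl | rfl <;> linarith
  have hβ1 : ε / 3 ≤ 1 - β := by rcases hβ with rfl | rfl <;> linarith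
  have hlogβ : ε / 3 ≤ -Real.log β := by linarith [Real.log_le_sub_one_of_pos hβ0]
  have hlog2 : Real.log 2 ≤ 1 := by linarith [Real.log_two_lt_d9]
  have hlog2' : 0 < Real.log 2 := Real.log_pos one_lt_two
  have hlogx : -Real.log x ≤ ℓ := by
    rw [Real.logb, one_div, Real.log_inv, div_le_iff₀ hlog2'] at hx
    nlinarith
  have hlogb : Real.logb β x ≤ ⌈3 / ε⌉₊ * ℓ := by
    have h1 : Real.logb β x ≤ 3 / ε * ℓ := by
      rw [Real.logb, ← neg_div_neg_eq, div_le_iff₀ (by linarith), div_mul_eq_mul_div,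
        div_mul_eq_mul_div, le_div_iff₀ hε]
      nlinarith
    exact h1.trans (mul_le_mul_of_nonneg_right hk (by linarith))
  have hcard : (weightValues β x).card ≤ ⌊Real.logb β x⌋₊ + 1 :=
    Finset.card_image_le.trans (by simp)
  have hfloor : (⌊Real.logb β x⌋₊ : ℝ) ≤ ⌈3 / ε⌉₊ * ℓ := by
    rcases le_total 0 (Real.logb β x) with h | h
    · exact (Nat.floor_le h).trans hlogb
    · rw [Nat.floor_of_nonpos h]
      have : (0 : ℝ) ≤ ℓ := by linarith
      simpa using mul_nonneg (Nat.cast_nonneg ⌈3 / ε⌉₊) this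
  have : ((weightValues β x).card : ℝ) ≤ (⌊Real.logb β x⌋₊ + 1 : ℕ) := by exact_mod_cast hcard
  push_cast at this
  linarith

/-- The order of the summands is irrelevant, and the resulting `m!` cancels `k ^ m` up to `e ^ k`.
Since `e < 4 ≤ ℓ ^ 2`, a pure power of `ℓ` with exponent `O(k)` remains. -/
theorem card_sumsOf_le {S : Finset ℝ} {k m : ℕ} {ℓ : ℝ} (hk : 2 ≤ k) (hℓ : 2 ≤ ℓ)
    (hS : (S.card : ℝ) ≤ k * ℓ + 1) (hm : m ≤ k + 1) :
    ((sumsOf S m).card : ℝ) ≤ ℓ ^ (4 * k + 2) := by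
  have hkR : (2 : ℝ) ≤ k := by exact_mod_cast hk
  have hmR : (m : ℝ) ≤ k + 1 := by exact_mod_cast hm
  have h1 : (sumsOf S m).card ≤ (S.card + m - 1).choose m :=
    Finset.card_image_le.trans ((Finset.card_sym_le S m).trans_eq (Nat.multichoose_eq _ _))
  have h2 : ((S.card + m - 1 : ℕ) : ℝ) ≤ 2 * ℓ * k := by
    have : ((S.card + m - 1 : ℕ) : ℝ) ≤ (S.card + m : ℕ) := by exact_mod_cast Nat.sub_le _ _
    push_cast at this
    nlinarith
  have h3 : Real.exp k ≤ ℓ ^ (2 * k) := by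
    rw [← mul_one (k : ℝ), Real.exp_nat_mul, pow_mul]
    have := Real.exp_one_lt_three
    exact pow_le_pow_left₀ (Real.exp_pos _).le (by nlinarith) _
  calc ((sumsOf S m).card : ℝ) ≤ ((S.card + m - 1).choose m : ℕ) := by exact_mod_cast h1
    _ ≤ ((S.card + m - 1 : ℕ) : ℝ) ^ m / m.factorial := Nat.choose_le_pow_div _ _
    _ ≤ (2 * ℓ * k) ^ m / m.factorial := by gcongr
    _ = (2 * ℓ) ^ m * ((k : ℝ) ^ m / m.factorial) := by rw [mul_pow, mul_div_assoc]
    _ ≤ (2 * ℓ) ^ m * Real.exp k := by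
      gcongr
      exact Real.pow_div_factorial_le_exp _ (Nat.cast_nonneg _) m
    _ ≤ (ℓ ^ 2) ^ m * ℓ ^ (2 * k) := by
      gcongr
      nlinarith
    _ = ℓ ^ (2 * m + 2 * k) := by rw [← pow_mul, ← pow_add]
    _ ≤ ℓ ^ (4 * k + 2) := pow_le_pow_right₀ (by linarith) (by omega)

theorem card_possibleGains_le {S : Finset ℝ} {k : ℕ} {ℓ : ℝ} (hk : 2 ≤ k) (hℓ : 2 ≤ ℓ)
    (hS : (S.card : ℝ) ≤ k * ℓ + 1) :
    ((possibleGains k S).card : ℝ) ≤ ℓ ^ (15 * k) := by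
  obtain ⟨N, hN⟩ : ∃ N : ℕ, N = ⌊ℓ ^ (4 * k + 2)⌋₊ := ⟨_, rfl⟩
  have hpos : (0 : ℝ) ≤ ℓ ^ (4 * k + 2) := by positivity
  have hsum : ∀ m ≤ k + 1, (sumsOf S m).card ≤ N := fun m hm => by
    rw [hN]
    exact Nat.le_floor (card_sumsOf_le hk hℓ hS hm)
  have hcard : (possibleGains k S).card ≤ (k + 1) * ((k + 2) * (N * N)) := by
    refine (Finset.card_filter_le _ _).trans ?_
    refine (Finset.card_biUnion_le_card_mul _ _ ((k + 2) * (N * N)) fun a ha => ?_).trans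
      (by simp)
    refine (Finset.card_biUnion_le_card_mul _ _ (N * N) fun b hb => ?_).trans (by simp)
    refine Finset.card_image_le.trans ?_
    rw [Finset.card_product]
    rw [Finset.mem_range] at ha hb
    exact Nat.mul_le_mul (hsum a (by omega)) (hsum b (by omega))
  have hNR : (N : ℝ) ≤ ℓ ^ (4 * k + 2) := hN ▸ Nat.floor_le hpos
  have htwo : ∀ j : ℕ, (j : ℝ) ≤ ℓ ^ j := fun j => by
    have h1 : (j : ℝ) ≤ 2 ^ j := by exact_mod_cast Nat.lt_two_pow_self.le
    exact h1.trans (pow_le_pow_left₀ (by norm_num) hℓ j)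
  calc ((possibleGains k S).card : ℝ) ≤ ((k + 1) * ((k + 2) * (N * N)) : ℕ) := by
        exact_mod_cast hcard
    _ = ((k + 1 : ℕ) : ℝ) * (((k + 2 : ℕ) : ℝ) * (N * N)) := by push_cast; ring
    _ ≤ ℓ ^ (k + 1) * (ℓ ^ (k + 2) * (ℓ ^ (4 * k + 2) * ℓ ^ (4 * k + 2))) := by
      gcongr
      · exact htwo _
      · exact htwo _
    _ = ℓ ^ (10 * k + 7) := by simp only [← pow_add]; congr 1; ring
    _ ≤ ℓ ^ (15 * k) := pow_le_pow_right₀ (by linarith) (by omega)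

/-! ### The final estimates -/

theorem OracleInput.stepRadius_le {A b n Δ k : ℕ} {C : ColoringAlg} (hn : 2 ≤ n) (hΔ : 1 ≤ Δ)
    (hk : 1 ≤ k) :
    (OracleInput.mk Δ (n ^ b) k C).stepRadius A ≤
      2 ^ ((3 * A + A * (b + 1) + 3 + 4 * (4 * A + 2)) * k) *
        (logStar n + Δ ^ (3 * A * k)) := by
  set P : OracleInput := ⟨Δ, n ^ b, k, C⟩ with hP
  obtain ⟨u, hu⟩ : ∃ u, u = 2 * k + 2 := ⟨_, rfl⟩
  have hdeg : P.gkDeg + 1 ≤ u ^ 4 * Δ ^ (2 * k + 1) := by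
    have h1 : 1 ≤ u ^ 3 * Δ ^ (2 * k + 1) :=
      Nat.mul_pos (Nat.pow_pos (by omega)) (Nat.pow_pos (by omega))
    have h2 : P.gkDeg = u ^ 3 * Δ ^ (2 * k + 1) := by rw [hu]; rfl
    calc P.gkDeg + 1 ≤ 2 * (u ^ 3 * Δ ^ (2 * k + 1)) := by omega
      _ ≤ u * (u ^ 3 * Δ ^ (2 * k + 1)) := Nat.mul_le_mul_right _ (by omega)
      _ = _ := by ring
  have hdegA : (P.gkDeg + 1) ^ A ≤ u ^ (4 * A) * Δ ^ (3 * A * k) := by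
    refine (Nat.pow_le_pow_left hdeg A).trans ?_
    rw [mul_pow, ← pow_mul, ← pow_mul]
    refine Nat.mul_le_mul_left _ (Nat.pow_le_pow_right hΔ ?_)
    nlinarith
  -- There are at most `(n ^ b + 1) ^ u ≤ n ^ ((b + 1) * u)` candidates, and an exponent costs
  -- `log*` at most its own value.
  have hlog : logStar P.candidates.length ≤ logStar n + (b + 1) * u := by
    refine logStar_le_of_le_pow ((length_seqs_le _ _).trans ?_)
    rw [pow_mul, hu]
    refine Nat.pow_le_pow_left ?_ _
    have : 1 ≤ n ^ b := Nat.one_le_pow _ _ (by omega)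
    calc n ^ b + 1 ≤ n ^ b * 2 := by omega
      _ ≤ n ^ (b + 1) := by rw [pow_succ]; exact Nat.mul_le_mul_left _ hn
  obtain ⟨z, hz⟩ : ∃ z, z = logStar n + Δ ^ (3 * A * k) := ⟨_, rfl⟩
  obtain ⟨y, hy⟩ : ∃ y, y = u ^ (4 * A) * z := ⟨_, rfl⟩
  have hzy : z ≤ y := hy ▸ Nat.le_mul_of_pos_left _ (Nat.pow_pos (by omega))
  have hz1 : 1 ≤ z := by
    have : 1 ≤ Δ ^ (3 * A * k) := Nat.one_le_pow _ _ hΔ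
    omega
  have hdegy : (P.gkDeg + 1) ^ A ≤ y :=
    hdegA.trans (hy ▸ Nat.mul_le_mul_left _ (by omega))
  have huy : (b + 1) * u ≤ (b + 1) * u * y := Nat.le_mul_of_pos_right _ (by omega)
  have hyu : y ≤ u * y := Nat.le_mul_of_pos_left _ (by omega)
  have hsum : P.gkColors A + P.gkRadius A + 3 ≤ (3 * A + A * (b + 1) + 3) * (u * y) := by
    have h1 : P.gkColors A ≤ A * (u * y) := Nat.mul_le_mul_left _ (hdegy.trans hyu)
    have h2 : P.gkRadius A ≤ A * (u * y + (b + 1) * (u * y) + u * y) := by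
      refine Nat.mul_le_mul_left _ (Nat.add_le_add ?_ (hdegy.trans hyu))
      rw [← mul_assoc (b + 1)]
      exact hlog.trans (Nat.add_le_add (by omega) huy)
    have h3 : 1 ≤ u * y := by omega
    nlinarith
  set c := 3 * A + A * (b + 1) + 3
  calc P.stepRadius A = (2 * k + 1) * (P.gkColors A + P.gkRadius A + 3) := rfl
    _ ≤ u * (c * (u * y)) := Nat.mul_le_mul (by omega) hsum
    _ = c * u ^ (4 * A + 2) * z := by rw [hy]; ring
    _ ≤ 2 ^ c * (2 ^ u) ^ (4 * A + 2) * z := by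
      gcongr
      · exact Nat.lt_two_pow_self.le
      · exact Nat.lt_two_pow_self.le
    _ = 2 ^ (c + u * (4 * A + 2)) * z := by rw [← pow_mul, ← pow_add]
    _ ≤ 2 ^ ((c + 4 * (4 * A + 2)) * k) * z := by
      refine Nat.mul_le_mul_right _ (Nat.pow_le_pow_right two_pos ?_)
      have h1 : c * 1 ≤ c * k := Nat.mul_le_mul_left _ hk
      have h2 : u * (4 * A + 2) ≤ 4 * k * (4 * A + 2) := Nat.mul_le_mul_right _ (by omega)
      nlinarith
    _ = _ := by rw [hz]

theorem sweeps_le {ε cL : ℝ} (hε : 0 < ε) (hε1 : ε < 1) {L : ℕ}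
    (hL : (L : ℝ) ≤ cL * (1 / ε * Real.logb 2 (2 / ε))) :
    L ≤ 2 ^ ((⌈|cL|⌉₊ + 2) * ⌈3 / ε⌉₊) := by
  have hk : 3 * (1 / ε) ≤ (⌈3 / ε⌉₊ : ℝ) := by
    rw [mul_one_div]
    exact Nat.le_ceil _
  set k := ⌈3 / ε⌉₊
  have hE : 1 < 1 / ε := (one_lt_div hε).2 hε1
  -- This crude bound suffices: `4 / ε ^ 2 ≤ k ^ 2` because `k ≥ 3 / ε`, and `k ^ 2` is absorbed by
  -- `2 ^ (2 * k)`.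
  have hlog : Real.logb 2 (2 / ε) ≤ 4 * (1 / ε) := by
    have h1 := Real.log_le_sub_one_of_pos (div_pos two_pos hε)
    have h2 := Real.log_two_gt_d9
    rw [Real.logb, div_le_iff₀ (by linarith)]
    have h3 : 2 / ε = 2 * (1 / ε) := by ring
    rw [h3] at h1 ⊢
    nlinarith
  have hlog0 : 0 ≤ Real.logb 2 (2 / ε) := by
    refine Real.logb_nonneg one_lt_two ?_
    rw [le_div_iff₀ hε]
    linarith
  have hk1 : 1 ≤ k := by
    have : (1 : ℝ) ≤ k := by linarith
    exact_mod_cast this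
  have h1 : (L : ℝ) ≤ (⌈|cL|⌉₊ * k ^ 2 : ℕ) := by
    push_cast
    calc (L : ℝ) ≤ |cL| * (1 / ε * Real.logb 2 (2 / ε)) :=
          hL.trans (mul_le_mul_of_nonneg_right (le_abs_self _) (by positivity))
      _ ≤ ⌈|cL|⌉₊ * (1 / ε * (4 * (1 / ε))) := by
          gcongr
          exact Nat.le_ceil _
      _ ≤ ⌈|cL|⌉₊ * (k : ℝ) ^ 2 := by
          gcongr
          nlinarith
  have h2 : L ≤ ⌈|cL|⌉₊ * k ^ 2 := by exact_mod_cast h1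
  calc L ≤ ⌈|cL|⌉₊ * k ^ 2 := h2
    _ ≤ 2 ^ ⌈|cL|⌉₊ * (2 ^ k) ^ 2 := by
      gcongr
      · exact Nat.lt_two_pow_self.le
      · exact Nat.lt_two_pow_self.le
    _ = 2 ^ (⌈|cL|⌉₊ + k * 2) := by rw [← pow_mul, ← pow_add]
    _ ≤ _ := by
      refine Nat.pow_le_pow_right two_pos ?_
      have : ⌈|cL|⌉₊ * 1 ≤ ⌈|cL|⌉₊ * k := Nat.mul_le_mul_left _ hk1
      nlinarith

theorem length_gains_le {c X : ℝ} {T k : ℕ} (hX : 2 ≤ X) (hk : 1 ≤ k)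
    (hT : (T : ℝ) ≤ (c * X) ^ (2 * k + 1)) : (T : ℝ) ≤ X ^ (3 * (⌈|c|⌉₊ + 1) * k) := by
  have h1 : |c| ≤ X ^ ⌈|c|⌉₊ := by
    have h2 : (⌈|c|⌉₊ : ℝ) ≤ 2 ^ ⌈|c|⌉₊ := by exact_mod_cast Nat.lt_two_pow_self.le
    exact (Nat.le_ceil _).trans (h2.trans (pow_le_pow_left₀ (by norm_num) hX _))
  calc (T : ℝ) ≤ |(c * X) ^ (2 * k + 1)| := hT.trans (le_abs_self _)
    _ = (|c| * X) ^ (2 * k + 1) := by rw [abs_pow, abs_mul, abs_of_nonneg (by linarith : 0 ≤ X)]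
    _ ≤ (X ^ ⌈|c|⌉₊ * X) ^ (2 * k + 1) := by gcongr
    _ = X ^ ((⌈|c|⌉₊ + 1) * (2 * k + 1)) := by rw [← pow_succ, ← pow_mul]
    _ ≤ _ := pow_le_pow_right₀ (by linarith) (by nlinarith)

/-- As `X ≥ 2`, all factors `2 ^ O(k)` become powers of `X`; since `k ≤ 4 / ε`, an exponent `a * k`
costs `4 * a` in `K`. Applied with `X = ℓ` and with `X = ℓ / ε`. -/
theorem final_estimate {ε X : ℝ} {k Δ s L T a₁ a₂ a₃ a₄ S K : ℕ} (hε : 0 < ε)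
    (hk : (k : ℝ) ≤ 4 / ε) (hX : 2 ≤ X) (hΔ : 1 ≤ Δ)
    (hL : L ≤ 2 ^ (a₁ * k)) (hT : (T : ℝ) ≤ X ^ (a₂ * k))
    (hS : S ≤ 2 ^ (a₃ * k) * (s + Δ ^ (a₄ * k)))
    (hK₁ : 4 * (a₁ + a₂ + a₃) ≤ K) (hK₂ : 4 * a₄ ≤ K) :
    ((L * T * S : ℕ) : ℝ) ≤ ((s : ℝ) + (Δ : ℝ) ^ ((K : ℝ) / ε)) * X ^ ((K : ℝ) / ε) := by
  have hexp : ∀ a : ℕ, 4 * a ≤ K → ∀ Y : ℝ, 1 ≤ Y → Y ^ (a * k) ≤ Y ^ ((K : ℝ) / ε) := by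
    intro a ha Y hY
    rw [← Real.rpow_natCast]
    refine Real.rpow_le_rpow_of_exponent_le hY ?_
    have ha' : (4 : ℝ) * a ≤ K := by exact_mod_cast ha
    push_cast
    calc (a : ℝ) * k ≤ a * (4 / ε) := by gcongr
      _ = 4 * a / ε := by ring
      _ ≤ K / ε := by gcongr
  have hL' : (L : ℝ) ≤ X ^ (a₁ * k) := by
    have : (L : ℝ) ≤ 2 ^ (a₁ * k) := by exact_mod_cast hL
    exact this.trans (pow_le_pow_left₀ (by norm_num) hX _)
  have hS' : (S : ℝ) ≤ X ^ (a₃ * k) * (s + (Δ : ℝ) ^ (a₄ * k)) := by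
    have : (S : ℝ) ≤ 2 ^ (a₃ * k) * (s + (Δ : ℝ) ^ (a₄ * k)) := by exact_mod_cast hS
    exact this.trans (mul_le_mul_of_nonneg_right (pow_le_pow_left₀ (by norm_num) hX _)
      (by positivity))
  have hX0 : 0 ≤ X := by linarith
  calc ((L * T * S : ℕ) : ℝ) = L * T * S := by push_cast; ring
    _ ≤ X ^ (a₁ * k) * X ^ (a₂ * k) * (X ^ (a₃ * k) * (s + (Δ : ℝ) ^ (a₄ * k))) := by gcongr
    _ = (s + (Δ : ℝ) ^ (a₄ * k)) * X ^ ((a₁ + a₂ + a₃) * k) := by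
      rw [add_mul (a₁ + a₂) a₃ k, add_mul a₁ a₂ k, pow_add, pow_add]; ring
    _ ≤ _ := by
      gcongr
      · exact hexp a₄ hK₂ Δ (by exact_mod_cast hΔ)
      · exact hexp _ hK₁ X (by linarith)

theorem mainTheorem4 :
    -- coloring algorithms of the required kind exist
    (∃ (A : ℕ) (C : ColoringAlg), IsColoringAlg A C) ∧
    -- and the oracles based on any of them have the claimed probe radius
    ∀ (A b : ℕ) (cL cT : ℝ), ∃ K : ℕ,
      ∀ (C : ColoringAlg), IsColoringAlg A C →
      ∀ (ε β : ℝ), 0 < ε → ε < 1 → (β = 1 - ε / 2 ∨ β = 1 - ε / 3) →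
      ∀ (G : LabeledGraph) (w : Sym2 ℕ → ℝ), (∀ v ∈ G.verts, v < G.order ^ b) →
      (∀ e ∈ G.graph.edgeSet, ε / G.order ≤ w e ∧ w e ≤ 1 ∧ ∃ z : ℤ, w e = β ^ z) →
      ∀ L : ℕ, 1 ≤ L → (L : ℝ) ≤ cL * (1 / ε * Real.logb 2 (2 / ε)) →
      -- `T_k` is the number of possible gains
      (∃ r : ℕ,
        ProbeRadiusLE G w
          (OracleInput.oracle ⟨G.maxDeg, G.order ^ b, ⌈3 / ε⌉₊, C⟩
            (gainList ⌈3 / ε⌉₊ (weightValues β (wmin ε G w))) L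
            (gainList ⌈3 / ε⌉₊ (weightValues β (wmin ε G w))).length) r ∧
        (r : ℝ) ≤ ((logStar G.order : ℝ) + (G.maxDeg : ℝ) ^ ((K : ℝ) / ε)) *
          (max 2 (Real.logb 2 (1 / wmin ε G w))) ^ ((K : ℝ) / ε)) ∧
      -- `T_k` is an upper bound `Θ(1/ε log (1/w_min))^(2k+1)` on the number of possible gains
      (∀ gains : List ℝ,
        (gains.length : ℝ) ≤
          (cT * (1 / ε * max 2 (Real.logb 2 (1 / wmin ε G w)))) ^ (2 * ⌈3 / ε⌉₊ + 1) →
        ∃ r : ℕ,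
          ProbeRadiusLE G w
            (OracleInput.oracle ⟨G.maxDeg, G.order ^ b, ⌈3 / ε⌉₊, C⟩ gains L gains.length) r ∧
          (r : ℝ) ≤ ((logStar G.order : ℝ) + (G.maxDeg : ℝ) ^ ((K : ℝ) / ε)) *
            (1 / ε * max 2 (Real.logb 2 (1 / wmin ε G w))) ^ ((K : ℝ) / ε)) := by
  refine ⟨exists_isColoringAlg, fun A b cL cT => ?_⟩
  obtain ⟨a₁, ha₁⟩ : ∃ a₁, a₁ = ⌈|cL|⌉₊ + 2 := ⟨_, rfl⟩
  obtain ⟨a₂, ha₂⟩ : ∃ a₂, a₂ = 3 * (⌈|cT|⌉₊ + 1) := ⟨_, rfl⟩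
  obtain ⟨a₃, ha₃⟩ : ∃ a₃, a₃ = 3 * A + A * (b + 1) + 3 + 4 * (4 * A + 2) := ⟨_, rfl⟩
  -- One `K` for both parts: `15` comes from the number of possible gains, `a₂` from the length of
  -- an arbitrary list, and `3 * A` from the power of the maximum degree.
  refine ⟨4 * (a₁ + (15 + a₂) + a₃ + 3 * A), ?_⟩
  intro C hC ε β hε hε1 hβ G w hids _ L hL1 hL
  obtain ⟨K, hK⟩ : ∃ K, K = 4 * (a₁ + (15 + a₂) + a₃ + 3 * A) := ⟨_, rfl⟩
  rw [← hK]
  obtain ⟨ℓ, hℓ⟩ : ∃ ℓ, ℓ = max 2 (Real.logb 2 (1 / wmin ε G w)) := ⟨_, rfl⟩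
  have hℓ2 : 2 ≤ ℓ := hℓ ▸ le_max_left _ _
  have hE : 1 < 1 / ε := (one_lt_div hε).2 hε1
  have hEℓ : 2 ≤ 1 / ε * ℓ := by nlinarith
  rw [← hℓ]
  have hkL : 3 / ε ≤ (⌈3 / ε⌉₊ : ℝ) := Nat.le_ceil _
  have hkU : (⌈3 / ε⌉₊ : ℝ) ≤ 4 / ε := by
    have h1 := (Nat.ceil_lt_add_one (by positivity : (0 : ℝ) ≤ 3 / ε)).le
    have h2 : 4 / ε = 3 / ε + 1 / ε := by ring
    linarith
  have hcard := card_weightValues_le hε hε1 hβ hℓ2 (x := wmin ε G w) (hℓ ▸ le_max_right _ _)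
  have hLk := sweeps_le hε hε1 hL
  rw [← ha₁] at hLk
  obtain ⟨k, hk⟩ : ∃ k, k = ⌈3 / ε⌉₊ := ⟨_, rfl⟩
  rw [← hk] at hkL hkU hcard hLk ⊢
  have hk2 : 2 ≤ k := by
    have h1 : 3 / ε = 3 * (1 / ε) := by ring
    have h2 : (2 : ℝ) ≤ k := by linarith
    exact_mod_cast h2
  by_cases hadj : ∃ u v, G.graph.Adj u v
  · obtain ⟨u, v, huv⟩ := hadj
    have hn : 2 ≤ G.order :=
      Finset.one_lt_card.2 ⟨u, G.mem_verts _ _ huv, v, G.mem_verts _ _ huv.symm, huv.ne⟩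
    have hΔ : 1 ≤ G.maxDeg :=
      (List.length_pos_of_mem ((G.mem_ports _ _).2 huv)).trans_le (G.length_ports_le u)
    have hfits : (OracleInput.mk G.maxDeg (G.order ^ b) k C).Fits G := ⟨rfl, hids⟩
    have hS := OracleInput.stepRadius_le (A := A) (b := b) (C := C) hn hΔ
      (by omega : 1 ≤ k)
    rw [← ha₃] at hS
    constructor
    · refine ⟨_, OracleInput.probeRadiusLE_oracle hC hfits _ hL1, ?_⟩
      refine final_estimate (a₂ := 15) hε hkU hℓ2 hΔ hLk ?_ hS (by omega) (by omega)
      rw [gainList, Finset.length_sort]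
      exact card_possibleGains_le hk2 hℓ2 hcard
    · intro gains hgains
      refine ⟨_, OracleInput.probeRadiusLE_oracle hC hfits _ hL1, ?_⟩
      refine final_estimate (a₂ := a₂) hε hkU hEℓ hΔ hLk ?_ hS (by omega) (by omega)
      rw [ha₂]
      exact length_gains_le hEℓ (by omega) hgains
  -- Without edges there are no queries. This case is separate because the estimates need `n ≥ 2`
  -- and `Δ ≥ 1`.
  · have hvac : ∀ O, ProbeRadiusLE G w O 0 := fun O u v huv => absurd ⟨u, v, huv⟩ hadj
    have hℓ0 : 0 ≤ ℓ := by linarith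
    exact ⟨⟨0, hvac _, by push_cast; positivity⟩,
      fun gains _ => ⟨0, hvac _, by push_cast; positivity⟩⟩
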